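/- **Setting.** Let $\Omega$ be the space of all $C^3$ functions $h:\mathbb{R}^2\to\mathbb{R}$ with the Fréchet topology generated by the seminorms $\|f\|_N=\sup_{|x|\le N}\sum_{k\le 3}|\nabla^k f(x)|$, $N\in\mathbb{N}$, and let $\tau_x h=h(\cdot+x)$. Let $\mathbb{P}$ be a Borel probability measure on $\Omega$ such that - (A) $\mathbb{P}(\tau_x^{-1}B)=\mathbb{P}(B)$ for all Borel $B$ and all $x\in\mathbb{R}^2$; - (B) if $B$ is Borel and $\tau_x(B)=B$ for all $x$, then $\mathbb{P}(B)\in\{0,1\}$; - (C) $\lim_{x\to0}\mathbb{P}(\|\tau_xh-h\|_N>\delta)=0$ for all $N\in\mathbb{N}$ and $\delta>0$; - (D) there is a constant $K>0$ such that, for $\mathbb{P}$-almost every $h$, $|\nabla h(x)|+|\nabla\nabla h(x)|\le K$ for all $x\in\mathbb{R}^2$. Put $g(x,h)=I+\nabla h(x)\otimes\nabla h(x)$, $|g|=\det g$, $g(h)=g(0,h)$, $$Z=\int_\Omega\sqrt{|g|(h)}\,\mathbb{P}(dh),\qquad \pi(dh)=\tfrac1Z\sqrt{|g|(h)}\,\mathbb{P}(dh),$$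 and $F(h)=\frac{1}{\sqrt{|g|}}\nabla\cdot\big(\sqrt{|g|}\,g^{-1}\big)(x,h)\big|_{x=0}$. Let $D_i$ be the $L^2(\mathbb{P})$-generator of $(\tau_{se_i})_{s\in\mathbb{R}}$, $H^1=\bigcap_i\mathcal{D}(D_i)$, and $\mathbb{D}=(D_1,D_2)$. Let $\mathcal{L}=\frac1{\sqrt{|g|}}\mathbb{D}\cdot\big(\sqrt{|g|}\,g^{-1}\mathbb{D}\big)$ be the self-adjoint operator in $L^2(\pi)$ given by the Dirichlet form with domain $H^1$: $\langle-\mathcal{L}u,\varphi\rangle_{L^2(\pi)}=\frac1Z\int_\Omega\mathbb{D}u\cdot g^{-1}\mathbb{D}\varphi\,\sqrt{|g|}\,d\mathbb{P}$ for all $\varphi\in H^1$. For $\lambda>0$ and $i=1,2$ let $\chi^{e_i}_\lambda\in L^2(\pi)$ solve $(\lambda-\mathcal{L})\chi^{e_i}_\lambda=F\cdot e_i$, and let $\chi_i=\lim_{\lambda\to0^+}\chi^{e_i}_\lambda$ in the completion $\mathcal{H}_1$ of $H^1$ (modulo constants) for the Dirichlet form; its elements are represented by their gradients in $L^2(\mathbb{P})^2$.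 With $(\mathbb{D}\chi)_{ij}=D_j\chi_i$, the effective diffusion tensor is $$D=\frac1Z\int_\Omega\big(I+\mathbb{D}\chi\big)\,g^{-1}\,\big(I+\mathbb{D}\chi\big)^{\top}\sqrt{|g|}\,d\mathbb{P}\in\mathbb{R}^{2\times2}.$$ **Theorem.** The tensor $D$ is well defined (the correctors and their limits exist, and they determine exactly one matrix), and $$\det D=\frac1{Z^2}.$$ Consequently $D$ has two real eigenvalues $\lambda_1\le\lambda_2$ (counted with multiplicity), and $$\frac1{Z^2}\le\lambda_1\le\frac1Z\le\lambda_2\le1.$$ In particular, if $D$ is isotropic, that is, $D=cI$ for some $c\in\mathbb{R}$, then $D=\frac1Z I$. -/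

import Mathlib

open MeasureTheory Filter Topology
open scoped Matrix

noncomputable section

/-- The space `Ω` of all `C³` functions `ℝ^d → ℝ` (realisations of the surface height). -/
structure SurfaceSpace (d : ℕ) where
  toFun : EuclideanSpace ℝ (Fin d) → ℝ
  contDiff' : ContDiff ℝ 3 toFun

namespace SurfaceSpace

variable {d : ℕ}

instance : CoeFun (SurfaceSpace d) (fun _ => EuclideanSpace ℝ (Fin d) → ℝ) := ⟨toFun⟩

/-- The `k`-th derivative of `h`, for `k ≤ 3`, as a continuous function. -/
def jet (k : Fin 4) (h : SurfaceSpace d) :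
    C(EuclideanSpace ℝ (Fin d), EuclideanSpace ℝ (Fin d) [×(k : ℕ)]→L[ℝ] ℝ) where
  toFun := iteratedFDeriv ℝ k h
  continuous_toFun := h.contDiff'.continuous_iteratedFDeriv (by
    have := k.is_lt
    exact_mod_cast (by omega : (k : ℕ) ≤ 3))

/-- The Fréchet topology of `C³(ℝ^d)`: uniform convergence on compact sets of all derivatives of
order at most `3`. -/
instance : TopologicalSpace (SurfaceSpace d) :=
  ⨅ k : Fin 4, TopologicalSpace.induced (jet k) inferInstance

instance : MeasurableSpace (SurfaceSpace d) := borel _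

instance : BorelSpace (SurfaceSpace d) := ⟨rfl⟩

/-- The value at `f - h` of the seminorm `sup_{|x| ≤ N} ∑_{k ≤ 3} |∇^k · (x)|`. -/
def seminormDist (N : ℕ) (f h : SurfaceSpace d) : ℝ :=
  ⨆ x : Metric.closedBall (0 : EuclideanSpace ℝ (Fin d)) (N : ℝ),
    ∑ k ∈ Finset.range 4, ‖iteratedFDeriv ℝ k (fun y => f y - h y) x‖

/-- The translation `τ_x h = h(· + x)`. -/
def translate (x : EuclideanSpace ℝ (Fin d)) (h : SurfaceSpace d) : SurfaceSpace d where
  toFun := fun y => h (y + x)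
  contDiff' := h.contDiff'.comp (contDiff_id.add contDiff_const)

/-! ### Assumptions on the law of the random field -/

/-- Stationarity. -/
def IsStationary (P : Measure (SurfaceSpace d)) : Prop :=
  ∀ B : Set (SurfaceSpace d), MeasurableSet B →
    ∀ x : EuclideanSpace ℝ (Fin d), P (translate x ⁻¹' B) = P B

/-- Ergodicity with respect to the group of translations. -/
def IsErgodicField (P : Measure (SurfaceSpace d)) : Prop :=
  ∀ B : Set (SurfaceSpace d), MeasurableSet B →
    (∀ x : EuclideanSpace ℝ (Fin d), translate x '' B = B) → P B = 0 ∨ P B = 1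

/-- Stochastic continuity: `τ_x h → h` in probability as `x → 0`, for each of the seminorms
defining the topology of `Ω`. -/
def IsStochContinuous (P : Measure (SurfaceSpace d)) : Prop :=
  ∀ N : ℕ, ∀ δ : ℝ, 0 < δ →
    Tendsto (fun x : EuclideanSpace ℝ (Fin d) =>
        P {h : SurfaceSpace d | δ < seminormDist N (translate x h) h})
      (𝓝 0) (𝓝 0)

/-- Almost surely, the first and second derivatives of `h` are bounded by a common deterministic
constant. -/
def HasBoundedDerivs (P : Measure (SurfaceSpace d)) : Prop :=
  ∃ K : ℝ, 0 < K ∧ ∀ᵐ h : SurfaceSpace d ∂P, ∀ x : EuclideanSpace ℝ (Fin d),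
    ‖fderiv ℝ h x‖ + ‖iteratedFDeriv ℝ 2 h x‖ ≤ K

/-! ### Geometry of the surface -/

/-- The metric tensor `g(x, h) = I + ∇h(x) ⊗ ∇h(x)`. -/
def metric (x : EuclideanSpace ℝ (Fin d)) (h : SurfaceSpace d) : Matrix (Fin d) (Fin d) ℝ :=
  1 + Matrix.vecMulVec (fun i => gradient h x i) (fun j => gradient h x j)

/-- The surface element `√|g|(x, h)`, with `|g| = det g`. -/
def area (x : EuclideanSpace ℝ (Fin d)) (h : SurfaceSpace d) : ℝ :=
  Real.sqrt (metric x h).det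

/-- The average surface area `Z = 𝔼[√|g|(h)]`, where `g(h) = g(0, h)`. -/
def meanArea (P : Measure (SurfaceSpace d)) : ℝ := ∫ h, area 0 h ∂P

/-- The drift `F(x, h) = |g|^{-1/2} ∇ · (√|g| g⁻¹)(x, h)`. -/
def drift (x : EuclideanSpace ℝ (Fin d)) (h : SurfaceSpace d) (j : Fin d) : ℝ :=
  1 / area x h * ∑ i : Fin d,
    fderiv ℝ (fun y => area y h * (metric y h)⁻¹ i j) x (EuclideanSpace.single i 1)

/-! ### Calculus on the probability space -/

/-- `f` is in the domain of `D_i`, the `L²(P)` generator of the translations in direction `e_i`,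
and `D_i f = f'`. -/
def HasL2Deriv (P : Measure (SurfaceSpace d)) (i : Fin d) (f f' : SurfaceSpace d → ℝ) : Prop :=
  MemLp f 2 P ∧ MemLp f' 2 P ∧
    Tendsto (fun s : ℝ =>
      eLpNorm (fun h => (f (translate (EuclideanSpace.single i s) h) - f h) / s - f' h) 2 P)
      (𝓝[≠] 0) (𝓝 0)

/-- `f` belongs to `H¹ = ⋂ᵢ 𝒟(D_i)` and `G = (D_i f)_i` is its gradient. -/
def HasL2Gradient (P : Measure (SurfaceSpace d)) (f : SurfaceSpace d → ℝ)
    (G : SurfaceSpace d → Fin d → ℝ) : Prop :=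
  ∀ i : Fin d, HasL2Deriv P i f (fun h => G h i)

/-- The inner product of `L²(π)`, where `π(dh) = Z⁻¹ √|g|(h) P(dh)`. -/
def innerPi (P : Measure (SurfaceSpace d)) (f φ : SurfaceSpace d → ℝ) : ℝ :=
  1 / meanArea P * ∫ h, f h * φ h * area 0 h ∂P

/-- The energy product `Z⁻¹ ∫ U · g⁻¹ W √|g| dP` of two vector fields. For gradients it is the
Dirichlet form, that is, the inner product of `ℋ₁`. -/
def energy (P : Measure (SurfaceSpace d)) (U W : SurfaceSpace d → Fin d → ℝ) : ℝ :=
  1 / meanArea P * ∫ h, (U h ⬝ᵥ ((metric 0 h)⁻¹ *ᵥ W h)) * area 0 h ∂P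

/-- `u ∈ 𝒟(ℒ)`, `𝔻u = U` and `ℒu = v`, where `ℒ = |g|^{-1/2} 𝔻 · (√|g| g⁻¹ 𝔻)` is the
self-adjoint operator in `L²(π)` associated with its Dirichlet form (with form domain `H¹`):
`⟨-ℒu, φ⟩_π = Z⁻¹ ∫ 𝔻u · g⁻¹ 𝔻φ √|g| dP` for all `φ ∈ H¹`. -/
def IsGenerator (P : Measure (SurfaceSpace d)) (u : SurfaceSpace d → ℝ)
    (U : SurfaceSpace d → Fin d → ℝ) (v : SurfaceSpace d → ℝ) : Prop :=
  HasL2Gradient P u U ∧ MemLp v 2 P ∧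
    ∀ (φ : SurfaceSpace d → ℝ) (Φ : SurfaceSpace d → Fin d → ℝ), HasL2Gradient P φ Φ →
      innerPi P (fun h => -v h) φ = energy P U Φ

/-- `u` is the `lam`-corrector in direction `e`, that is, the solution in `L²(π)` of the resolvent
equation `(lam - ℒ) u = F · e`, and `U` is its gradient. -/
def IsCorrector (P : Measure (SurfaceSpace d)) (e : Fin d → ℝ) (lam : ℝ)
    (u : SurfaceSpace d → ℝ) (U : SurfaceSpace d → Fin d → ℝ) : Prop :=
  ∃ v : SurfaceSpace d → ℝ, IsGenerator P u U v ∧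
    ∀ᵐ h ∂P, lam * u h - v h = drift 0 h ⬝ᵥ e

/-- `V = 𝔻χ^e`, where `χ^e` is the limit in `ℋ₁` of the `lam`-correctors as `lam → 0⁺`. Elements
of the completion `ℋ₁` are represented by their gradients in `(L²(P))^d`. -/
def IsLimitCorrectorGradient (P : Measure (SurfaceSpace d)) (e : Fin d → ℝ)
    (V : SurfaceSpace d → Fin d → ℝ) : Prop :=
  (∀ i : Fin d, MemLp (fun h => V h i) 2 P) ∧
    ∃ (u : ℝ → SurfaceSpace d → ℝ) (U : ℝ → SurfaceSpace d → Fin d → ℝ),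
      (∀ lam : ℝ, 0 < lam → IsCorrector P e lam (u lam) (U lam)) ∧
      Tendsto (fun lam : ℝ => energy P (fun h => U lam h - V h) (fun h => U lam h - V h))
        (𝓝[>] 0) (𝓝 0)

/-- `D = Z⁻¹ ∫ (I + 𝔻χ) g⁻¹ (I + 𝔻χ)ᵀ √|g| dP`, where `(𝔻χ)_{ij} = D_j χ^{e_i}`. -/
def IsEffectiveDiffusion (P : Measure (SurfaceSpace d)) (D : Matrix (Fin d) (Fin d) ℝ) : Prop :=
  ∃ V : SurfaceSpace d → Matrix (Fin d) (Fin d) ℝ,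
    (∀ i : Fin d, IsLimitCorrectorGradient P (Pi.single i 1) (fun h => V h i)) ∧
    ∀ i j : Fin d, D i j = 1 / meanArea P *
      ∫ h, ((1 + V h) * (metric 0 h)⁻¹ * (1 + V h).transpose) i j * area 0 h ∂P

end SurfaceSpace

end

/-! Put `A = √|g| g⁻¹`. The theorem is Keller–Dykhne duality for this coefficient: in dimension two
`A` is symmetric with determinant one, so `A J A = J`, where `J` is the rotation by a right angle.

Translations act on `L²(P)` as a strongly continuous unitary group. Gradients have mean zero
(`inner_const_potentials`) and are orthogonal to rotated gradients (`inner_rot_potentials`), the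
latter because the determinant is a null Lagrangian. An `L²` field that is both divergence-free and
curl-free is invariant (`apply_eq_self_of_weak`), hence constant by ergodicity. Therefore every
divergence-free field is, after rotation, a potential field plus a constant (`exists_rot_eq`).

Let `V₀`, `V₁` be the gradients of the two correctors. The flux `q = A(e₀ + V₀)` is divergence-free,
so `J q = r + b` with `r` a potential field and `b` constant; the mean of `q` identifies `b` with
`(-Q₁₀, Q₀₀)`, where `Q = Z D`. Pair `J q` with the flux `A(e₁ + V₁)`. By `A J A = J` the result is
`⟨J(e₀ + V₀), e₁ + V₁⟩ = 1`. By the decomposition it is `b₀ Q₀₁ + b₁ Q₁₁ = det Q`, since `r` is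
orthogonal to fluxes. Hence `det Q = 1` (`effective_det`) and `det D = Z⁻²`.

For the eigenvalues, the variational bound `Q ≤ 𝔼[A]` (`effective_le`) and the pointwise bound `A ≤
√|g| I` give `D ≤ I`; the rest follows from the value of the product of the eigenvalues.

Well-definedness rests on Lax–Milgram: the limit corrector solves a coercive problem on the closure
of the gradients, the resolvent solutions converge to it (`tendsto_of_isResolvent`), and coercivity
makes it unique. -/

noncomputable section

/-! ### Unitary representations: generators and averages. -/

/-- A strongly continuous representation of the additive group of `E` by linear isometries
of `H`. -/
structure UnitaryRep (E H : Type*) [NormedAddCommGroup E] [NormedSpace ℝ E]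
    [NormedAddCommGroup H] [InnerProductSpace ℝ H] where
  toFun : E → H →ₗᵢ[ℝ] H
  zero_apply : ∀ f, toFun 0 f = f
  add_apply : ∀ x y f, toFun (x + y) f = toFun x (toFun y f)
  continuous_orbit : ∀ f, Continuous fun x => toFun x f

namespace UnitaryRep

variable {E H : Type*} [NormedAddCommGroup E] [NormedSpace ℝ E]
  [NormedAddCommGroup H] [InnerProductSpace ℝ H]

instance : CoeFun (UnitaryRep E H) (fun _ => E → H →ₗᵢ[ℝ] H) := ⟨toFun⟩

variable (T : UnitaryRep E H)

lemma comm_apply (x y : E) (f : H) : T x (T y f) = T y (T x f) := by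
  rw [← T.add_apply, add_comm, T.add_apply]

lemma neg_apply_apply (x : E) (f : H) : T (-x) (T x f) = f := by
  rw [← T.add_apply, neg_add_cancel, T.zero_apply]

lemma inner_apply_left (x : E) (f g : H) : inner ℝ (T x f) g = inner ℝ f (T (-x) g) := by
  rw [← (T (-x)).inner_map_map, T.neg_apply_apply]

lemma continuous_line (v : E) (f : H) : Continuous fun s : ℝ => T (s • v) f :=
  (T.continuous_orbit f).comp (by fun_prop)

/-- `f'` is the derivative of `f` along the one-parameter group of direction `v`. -/
def IsDeriv (v : E) (f f' : H) : Prop := HasDerivAt (fun s : ℝ => T (s • v) f) f' 0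

variable {T} {v w : E} {f g f' g' : H}

lemma isDeriv_iff_tendsto : T.IsDeriv v f f' ↔
    Tendsto (fun s : ℝ => s⁻¹ • (T (s • v) f - f)) (𝓝[≠] 0) (𝓝 f') := by
  rw [IsDeriv, hasDerivAt_iff_tendsto_slope_zero]
  simp [T.zero_apply]

lemma IsDeriv.add (hf : T.IsDeriv v f f') (hg : T.IsDeriv v g g') :
    T.IsDeriv v (f + g) (f' + g') := by
  exact (HasDerivAt.add hf hg).congr_of_eventuallyEq (Eventually.of_forall fun s => by simp)

lemma IsDeriv.const_smul (c : ℝ) (hf : T.IsDeriv v f f') : T.IsDeriv v (c • f) (c • f') := by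
  exact (HasDerivAt.const_smul c hf).congr_of_eventuallyEq (Eventually.of_forall fun s => by simp)

lemma isDeriv_zero : T.IsDeriv v 0 0 := by
  simpa [IsDeriv] using hasDerivAt_const (0 : ℝ) (0 : H)

lemma IsDeriv.neg_dir (hf : T.IsDeriv v f f') : T.IsDeriv (-v) f (-f') := by
  have h : HasDerivAt (fun s : ℝ => T (s • v) f) f' (-0) := by rwa [neg_zero]
  simpa [IsDeriv, Function.comp_def] using HasDerivAt.scomp (0 : ℝ) h (hasDerivAt_neg (0 : ℝ))

lemma IsDeriv.map (L : H →L[ℝ] H) (hL : ∀ x f, T x (L f) = L (T x f)) (hf : T.IsDeriv v f f') :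
    T.IsDeriv v (L f) (L f') := by
  exact (L.hasFDerivAt.comp_hasDerivAt (0 : ℝ) hf).congr_of_eventuallyEq
    (Eventually.of_forall fun s => hL _ _)

lemma IsDeriv.hasDerivAt (hf : T.IsDeriv v f f') (t : ℝ) :
    HasDerivAt (fun s : ℝ => T (s • v) f) (T (t • v) f') t := by
  have h0 : HasDerivAt (fun s : ℝ => T (s • v) f) f' (t - t) := by rwa [sub_self]
  have h1 : HasDerivAt (fun s : ℝ => T ((s - t) • v) f) f' t := h0.comp_sub_const t t
  have h2 := (T (t • v)).toContinuousLinearMap.hasFDerivAt.comp_hasDerivAt t h1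
  refine h2.congr_of_eventuallyEq (Eventually.of_forall fun s => ?_)
  simp [← T.add_apply, ← add_smul]

section Complete

variable [CompleteSpace H]

lemma IsDeriv.sub_eq_integral (hf : T.IsDeriv v f f') (t : ℝ) :
    T (t • v) f - f = ∫ s in (0 : ℝ)..t, T (s • v) f' := by
  rw [intervalIntegral.integral_eq_sub_of_hasDerivAt (fun s _ => hf.hasDerivAt s)
    ((T.continuous_line v f').intervalIntegrable _ _)]
  simp [T.zero_apply]

lemma isDeriv_of_sub_eq_integral
    (h : ∀ t : ℝ, T (t • v) f - f = ∫ s in (0 : ℝ)..t, T (s • v) f') : T.IsDeriv v f f' := by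
  have h1 : HasDerivAt (fun t : ℝ => ∫ s in (0 : ℝ)..t, T (s • v) f') (T ((0 : ℝ) • v) f') 0 :=
    intervalIntegral.integral_hasDerivAt_right (by simp)
      ((T.continuous_line v f').stronglyMeasurableAtFilter _ _)
      (T.continuous_line v f').continuousAt
  have h2 := h1.add_const f
  simp only [zero_smul, T.zero_apply] at h2
  refine h2.congr_of_eventuallyEq (Eventually.of_forall fun t => ?_)
  simp [← h t]

/-- The graph of the generator is closed. -/
lemma isClosed_isDeriv (v : E) : IsClosed {p : H × H | T.IsDeriv v p.1 p.2} := by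
  -- The integrated form of the derivative involves only maps continuous in the pair, so it passes
  -- to limits.
  have key : {p : H × H | T.IsDeriv v p.1 p.2} =
      ⋂ t : ℝ, {p : H × H | T (t • v) p.1 - p.1 = ∫ s in (0 : ℝ)..t, T (s • v) p.2} := by
    ext p
    simp only [Set.mem_ofPred_eq, Set.mem_iInter]
    exact ⟨fun h t => h.sub_eq_integral t, isDeriv_of_sub_eq_integral⟩
  rw [key]
  refine isClosed_iInter fun t => isClosed_eq ?_ ?_
  · exact ((T (t • v)).continuous.comp continuous_fst).sub continuous_fst
  · refine Continuous.comp (g := fun f : H => ∫ s in (0 : ℝ)..t, T (s • v) f) ?_ continuous_snd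
    have hlip : LipschitzWith (Real.toNNReal |t|)
        (fun f : H => ∫ s in (0 : ℝ)..t, T (s • v) f) := by
      refine LipschitzWith.of_dist_le_mul fun f g => ?_
      rw [dist_eq_norm, ← intervalIntegral.integral_sub
        ((T.continuous_line v f).intervalIntegrable _ _)
        ((T.continuous_line v g).intervalIntegrable _ _), dist_eq_norm]
      have := intervalIntegral.norm_integral_le_of_norm_le_const (a := 0) (b := t)
        (f := fun s : ℝ => T (s • v) f - T (s • v) g) (C := ‖f - g‖)
        (fun s _ => by rw [← map_sub, LinearIsometry.norm_map])
      simpa [mul_comm] using this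
    exact hlip.continuous

end Complete

/-- Integration by parts: the adjoint of `T (s • v)` is `T (s • -v)`, so the generator is
antisymmetric. -/
lemma IsDeriv.inner_eq (hf : T.IsDeriv v f f') (hg : T.IsDeriv v g g') :
    inner ℝ f' g = -inner ℝ f g' := by
  have h1 : HasDerivAt (fun s : ℝ => inner ℝ (T (s • v) f) g) (inner ℝ f' g) 0 := by
    simpa using HasDerivAt.inner ℝ hf (hasDerivAt_const (0 : ℝ) g)
  have h2 : HasDerivAt (fun s : ℝ => inner ℝ f (T (s • -v) g)) (inner ℝ f (-g')) 0 := by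
    simpa using HasDerivAt.inner ℝ (hasDerivAt_const (0 : ℝ) f) hg.neg_dir
  have h3 : (fun s : ℝ => inner ℝ (T (s • v) f) g) = fun s : ℝ => inner ℝ f (T (s • -v) g) := by
    funext s
    rw [T.inner_apply_left, smul_neg]
  rw [h3] at h1
  rw [h1.unique h2, inner_neg_right]

/-- Derivatives in two directions can be exchanged between the factors of an inner product:
"the curl of a gradient vanishes", in weak form. -/
lemma IsDeriv.inner_comm {fv fw gv gw : H} (hfv : T.IsDeriv v f fv) (hfw : T.IsDeriv w f fw)
    (hgv : T.IsDeriv v g gv) (hgw : T.IsDeriv w g gw) :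
    inner ℝ fv gw = inner ℝ fw gv := by
  -- No second derivatives are available, so the exchange is done on difference quotients. Unitarity
  -- and commutation make the product of the increments along `v`, `w` equal to that of the
  -- increments along `-w`, `-v`, exactly for each `s`.
  have h1 := (isDeriv_iff_tendsto.1 hfv).inner (𝕜 := ℝ) (isDeriv_iff_tendsto.1 hgw)
  have h2 := (isDeriv_iff_tendsto.1 hfw.neg_dir).inner (𝕜 := ℝ) (isDeriv_iff_tendsto.1 hgv.neg_dir)
  rw [inner_neg_neg] at h2
  refine tendsto_nhds_unique h1 (h2.congr fun s => ?_)
  have e1 : ∀ f g : H, inner ℝ (T (s • -w) f) (T (s • -v) g) = inner ℝ (T (s • v) f) (T (s • w) g) := by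
    intro f g
    rw [smul_neg, smul_neg, ← T.inner_apply_left, T.comm_apply, real_inner_comm,
      ← neg_neg (s • w), ← T.inner_apply_left, real_inner_comm, neg_neg]
  have e2 : ∀ f g : H, inner ℝ (T (s • -w) f) g = inner ℝ f (T (s • w) g) := by
    intro f g
    rw [T.inner_apply_left, smul_neg, neg_neg]
  have e3 : ∀ f g : H, inner ℝ f (T (s • -v) g) = inner ℝ (T (s • v) f) g := by
    intro f g
    rw [T.inner_apply_left, smul_neg]
  simp only [real_inner_smul_left, inner_smul_right, inner_sub_left, inner_sub_right]
  rw [e1, e2, e3]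
  ring

section Average

variable [CompleteSpace H] (T)

/-- The average `ε⁻¹ ∫₀^ε T (s • v) ds`. -/
def avg (v : E) (ε : ℝ) : H →L[ℝ] H :=
  LinearMap.mkContinuous
    { toFun := fun f => ε⁻¹ • ∫ s in (0 : ℝ)..ε, T (s • v) f
      map_add' := fun f g => by
        rw [← smul_add, ← intervalIntegral.integral_add
          ((T.continuous_line v f).intervalIntegrable _ _)
          ((T.continuous_line v g).intervalIntegrable _ _)]
        simp
      map_smul' := fun c f => by
        simp only [map_smul, intervalIntegral.integral_smul, RingHom.id_apply]
        rw [smul_comm] } (|ε⁻¹| * |ε|) (fun f => by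
    have := intervalIntegral.norm_integral_le_of_norm_le_const (a := 0) (b := ε)
      (f := fun s : ℝ => T (s • v) f) (C := ‖f‖) (fun s _ => by rw [LinearIsometry.norm_map])
    simp only [LinearMap.coe_mk, AddHom.coe_mk, norm_smul, Real.norm_eq_abs]
    rw [mul_assoc]
    gcongr
    simpa [mul_comm] using this)

lemma avg_apply (v : E) (ε : ℝ) (f : H) :
    T.avg v ε f = ε⁻¹ • ∫ s in (0 : ℝ)..ε, T (s • v) f := rfl

lemma apply_avg (x v : E) (ε : ℝ) (f : H) : T x (T.avg v ε f) = T.avg v ε (T x f) := by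
  have := (T x).toContinuousLinearMap.intervalIntegral_comp_comm
    ((T.continuous_line v f).intervalIntegrable (μ := volume) 0 ε)
  simp only [LinearIsometry.coe_toContinuousLinearMap] at this
  rw [avg_apply, avg_apply, map_smul, ← this]
  simp only [T.comm_apply x]

lemma inner_avg_left (v : E) (ε : ℝ) (f g : H) :
    inner ℝ (T.avg v ε f) g = inner ℝ f (T.avg (-v) ε g) := by
  have h1 := (innerSL ℝ g).intervalIntegral_comp_comm
    ((T.continuous_line v f).intervalIntegrable (μ := volume) 0 ε)
  have h2 := (innerSL ℝ f).intervalIntegral_comp_comm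
    ((T.continuous_line (-v) g).intervalIntegrable (μ := volume) 0 ε)
  simp only [innerSL_apply_apply] at h1 h2
  rw [avg_apply, avg_apply, real_inner_comm, inner_smul_right, inner_smul_right, ← h1, ← h2]
  congr 2
  funext s
  rw [real_inner_comm, T.inner_apply_left, smul_neg]

/-- Averaging regularizes: the derivative of an average is a difference quotient of the integrand,
whatever the vector `f`. -/
lemma isDeriv_avg (v : E) (ε : ℝ) (f : H) :
    T.IsDeriv v (T.avg v ε f) (ε⁻¹ • (T (ε • v) f - f)) := by
  have hc := T.continuous_line v f
  have hd : ∀ t : ℝ, HasDerivAt (fun t : ℝ => ∫ s in (0 : ℝ)..t, T (s • v) f) (T (t • v) f) t :=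
    fun t => intervalIntegral.integral_hasDerivAt_right (hc.intervalIntegrable _ _)
      (hc.stronglyMeasurableAtFilter _ _) hc.continuousAt
  have h1 : HasDerivAt (fun t : ℝ => ∫ s in (0 : ℝ)..(t + ε), T (s • v) f) (T (ε • v) f) 0 := by
    have : HasDerivAt (fun t : ℝ => ∫ s in (0 : ℝ)..t, T (s • v) f) (T (ε • v) f) (0 + ε) := by
      simpa using hd ε
    exact this.comp_add_const 0 ε
  have h2 : HasDerivAt (fun t : ℝ => ∫ s in (0 : ℝ)..t, T (s • v) f) f 0 := by
    simpa [T.zero_apply] using hd 0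
  refine ((h1.sub h2).const_smul ε⁻¹).congr_of_eventuallyEq (Eventually.of_forall fun t => ?_)
  have h3 := (T (t • v)).toContinuousLinearMap.intervalIntegral_comp_comm
    (hc.intervalIntegrable (μ := volume) 0 ε)
  simp only [LinearIsometry.coe_toContinuousLinearMap, ← T.add_apply, ← add_smul] at h3
  simp only [avg_apply, map_smul, ← h3, Pi.smul_apply, Pi.sub_apply]
  rw [intervalIntegral.integral_interval_sub_left (hc.intervalIntegrable _ _)
    (hc.intervalIntegrable _ _), intervalIntegral.integral_comp_add_left
    (fun s : ℝ => T (s • v) f)]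
  simp

lemma tendsto_avg (v : E) (f : H) : Tendsto (fun ε => T.avg v ε f) (𝓝[≠] 0) (𝓝 f) := by
  have hc := T.continuous_line v f
  have h : HasDerivAt (fun t : ℝ => ∫ s in (0 : ℝ)..t, T (s • v) f) f 0 := by
    have := intervalIntegral.integral_hasDerivAt_right (hc.intervalIntegrable (μ := volume) 0 0)
      (hc.stronglyMeasurableAtFilter _ _) hc.continuousAt
    simpa [T.zero_apply] using this
  simpa [avg_apply] using h.tendsto_slope_zero

lemma norm_avg_apply_le (v : E) (ε : ℝ) (f : H) : ‖T.avg v ε f‖ ≤ ‖f‖ := by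
  have h : ‖T.avg v ε f‖ ≤ |ε⁻¹| * |ε| * ‖f‖ := by
    refine ContinuousLinearMap.le_of_opNorm_le _ (LinearMap.mkContinuous_norm_le _ (by positivity) _) f
  refine h.trans (mul_le_of_le_one_left (norm_nonneg _) ?_)
  rw [← abs_mul]
  -- At `ε = 0` the factor is `0` because `0⁻¹ = 0`.
  rcases eq_or_ne ε 0 with rfl | hε <;> simp [*]

/-- Both averages use the same `ε`; the outer one is a contraction uniformly in `ε`, which absorbs
the error of the inner one. -/
lemma tendsto_avg_avg (v w : E) (f : H) :
    Tendsto (fun ε => T.avg v ε (T.avg w ε f)) (𝓝[≠] 0) (𝓝 f) := by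
  have h1 : Tendsto (fun ε => T.avg v ε (T.avg w ε f - f)) (𝓝[≠] 0) (𝓝 0) := by
    refine squeeze_zero_norm (fun ε => T.norm_avg_apply_le v ε _) ?_
    have := ((T.tendsto_avg w f).sub_const f).norm
    simpa using this
  simpa using h1.add (T.tendsto_avg v f)

end Average

/-- A vector all of whose derivatives along `v` vanish is fixed by the group of direction `v`. -/
lemma IsDeriv.apply_eq_self [CompleteSpace H] (h : T.IsDeriv v f 0) (s : ℝ) : T (s • v) f = f := by
  simpa [sub_eq_zero] using h.sub_eq_integral s

end UnitaryRep

/-! ### Coercive problems; vector fields and their rotation. -/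

/-- **Lax–Milgram** on a complete subspace, for an operator that is coercive there. -/
lemma exists_mem_forall_inner_eq {X : Type*} [NormedAddCommGroup X] [InnerProductSpace ℝ X]
    (M : Submodule ℝ X) [CompleteSpace M] (A : X →L[ℝ] X) {α : ℝ} (hα : 0 < α)
    (hA : ∀ u ∈ M, α * ‖u‖ ^ 2 ≤ inner ℝ (A u) u) (x : X) :
    ∃ u ∈ M, ∀ φ ∈ M, inner ℝ (A u) φ = inner ℝ x φ := by
  let B : M →L[ℝ] M →L[ℝ] ℝ := LinearMap.mkContinuous₂
    (LinearMap.mk₂ ℝ (fun u φ : M => inner ℝ (A u) (φ : X))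
      (fun _ _ _ => by simp [inner_add_left]) (fun _ _ _ => by simp [real_inner_smul_left])
      (fun _ _ _ => by simp [inner_add_right]) (fun _ _ _ => by simp [inner_smul_right]))
    ‖A‖ (fun u φ => by
      simp only [LinearMap.mk₂_apply]
      refine (norm_inner_le_norm _ _).trans ?_
      gcongr
      exacts [A.le_opNorm _, le_rfl])
  have hB : IsCoercive B := ⟨α, hα, fun u => by
    have := hA u u.2
    rw [sq, ← mul_assoc] at this
    exact this⟩
  -- On `M` the functional `⟨x, ·⟩` is represented by the orthogonal projection of `x`.
  obtain ⟨u, hu⟩ := hB.continuousLinearEquivOfBilin.surjective (M.orthogonalProjectionOnto x)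
  refine ⟨u, u.2, fun φ hφ => ?_⟩
  have h := hB.continuousLinearEquivOfBilin_apply u ⟨φ, hφ⟩
  rw [hu] at h
  have h2 : B u ⟨φ, hφ⟩ = inner ℝ (A u) φ := rfl
  rw [← h2, ← h, Submodule.coe_inner]
  have h3 : inner ℝ (x - M.orthogonalProjectionOnto x) φ = 0 :=
    Submodule.starProjection_inner_eq_zero x φ hφ
  rw [inner_sub_left, sub_eq_zero] at h3
  exact h3.symm

/-- Pairs of vectors of `H`: the vector fields with components in `H`. -/
abbrev VecField (H : Type*) := PiLp 2 (fun _ : Fin 2 => H)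

namespace VecField

variable {H : Type*} [NormedAddCommGroup H] [InnerProductSpace ℝ H]

/-- The operator on vector fields given by a matrix of operators. -/
def matOp (a : Fin 2 → Fin 2 → H →L[ℝ] H) : VecField H →L[ℝ] VecField H :=
  ((PiLp.continuousLinearEquiv 2 ℝ (fun _ : Fin 2 => H)).symm : (Fin 2 → H) →L[ℝ] VecField H) ∘L
    ContinuousLinearMap.pi (fun i => ∑ j, a i j ∘L ContinuousLinearMap.proj j) ∘L
    ((PiLp.continuousLinearEquiv 2 ℝ (fun _ : Fin 2 => H)) : VecField H →L[ℝ] (Fin 2 → H))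

lemma matOp_apply (a : Fin 2 → Fin 2 → H →L[ℝ] H) (U : VecField H) (i : Fin 2) :
    matOp a U i = a i 0 (U 0) + a i 1 (U 1) := by
  simp [matOp, Fin.sum_univ_two]

/-- Rotation of vector fields by a right angle. -/
def rot : VecField H →L[ℝ] VecField H :=
  matOp ![![0, -ContinuousLinearMap.id ℝ H], ![ContinuousLinearMap.id ℝ H, 0]]

@[simp] lemma rot_apply_zero (U : VecField H) : rot U 0 = -U 1 := by simp [rot, matOp_apply]

@[simp] lemma rot_apply_one (U : VecField H) : rot U 1 = U 0 := by simp [rot, matOp_apply]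

lemma inner_eq (U V : VecField H) : inner ℝ U V = inner ℝ (U 0) (V 0) + inner ℝ (U 1) (V 1) := by
  simp [PiLp.inner_apply, Fin.sum_univ_two]

lemma inner_rot_left (U V : VecField H) : inner ℝ (rot U) V = -inner ℝ U (rot V) := by
  simp only [inner_eq, rot_apply_zero, rot_apply_one, inner_neg_left, inner_neg_right]
  ring

lemma inner_rot_rot (U V : VecField H) : inner ℝ (rot U) (rot V) = inner ℝ U V := by
  simp only [inner_eq, rot_apply_zero, rot_apply_one, inner_neg_neg]
  ring

/-- The vector field `e ↦ (e₀ • o, e₁ • o)`. -/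
def const (o : H) : (Fin 2 → ℝ) →ₗ[ℝ] VecField H where
  toFun e := WithLp.toLp 2 fun i => e i • o
  map_add' e f := by ext i; simp [add_smul]
  map_smul' c e := by ext i; simp [mul_smul]

@[simp] lemma const_apply (o : H) (e : Fin 2 → ℝ) (i : Fin 2) : const o e i = e i • o := rfl

lemma rot_const_zero (o : H) : rot (const o (Pi.single 0 1)) = const o (Pi.single 1 1) := by
  ext i; fin_cases i <;> simp

lemma rot_const_one (o : H) : rot (const o (Pi.single 1 1)) = -const o (Pi.single 0 1) := by
  ext i; fin_cases i <;> simp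

end VecField

/-! ### Liouville's theorem and the space of gradients. -/

namespace UnitaryRep

open VecField

variable {E H : Type*} [NormedAddCommGroup E] [NormedSpace ℝ E]
  [NormedAddCommGroup H] [InnerProductSpace ℝ H] (T : UnitaryRep E H)

/-- Vectors with derivatives in two directions are dense. -/
lemma eq_zero_of_forall_isDeriv [CompleteSpace H] (v w : E) (x : H)
    (h : ∀ φ φv φw, T.IsDeriv v φ φv → T.IsDeriv w φ φw → inner ℝ x φ = 0) : x = 0 := by
  have h1 : Tendsto (fun ε => inner ℝ x (T.avg v ε (T.avg w ε x))) (𝓝[≠] 0) (𝓝 (inner ℝ x x)) :=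
    tendsto_const_nhds.inner (T.tendsto_avg_avg v w x)
  have h2 : ∀ ε, inner ℝ x (T.avg v ε (T.avg w ε x)) = 0 := fun ε =>
    h _ _ _ (T.isDeriv_avg v ε _) ((T.isDeriv_avg w ε x).map _ fun y f => T.apply_avg y v ε f)
  simp only [h2] at h1
  exact inner_self_eq_zero.1 (tendsto_nhds_unique h1 tendsto_const_nhds)

/-- **Liouville's theorem**: the first component of a weakly divergence-free and curl-free
vector field is invariant. -/
lemma apply_eq_self_of_weak [CompleteSpace H] {v w : E} {a b : H}
    (hdiv : ∀ φ φv φw, T.IsDeriv v φ φv → T.IsDeriv w φ φw → inner ℝ a φv + inner ℝ b φw = 0)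
    (hcurl : ∀ φ φv φw, T.IsDeriv v φ φv → T.IsDeriv w φ φw → inner ℝ a φw - inner ℝ b φv = 0)
    (s : ℝ) : T (s • v) a = a ∧ T (s • w) a = a := by
  -- The weak equations are first made strong by averaging in both directions; the invariance is
  -- then passed to the limit `ε → 0`.
  have key : ∀ ε, T (s • v) (T.avg v ε (T.avg w ε a)) = T.avg v ε (T.avg w ε a) ∧
      T (s • w) (T.avg v ε (T.avg w ε a)) = T.avg v ε (T.avg w ε a) := by
    intro ε
    have hv : ∀ f, ∃ f', T.IsDeriv v (T.avg v ε (T.avg w ε f)) f' := fun f =>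
      ⟨_, T.isDeriv_avg v ε _⟩
    have hw : ∀ f, ∃ f', T.IsDeriv w (T.avg v ε (T.avg w ε f)) f' := fun f =>
      ⟨_, (T.isDeriv_avg w ε f).map _ fun y f => T.apply_avg y v ε f⟩
    obtain ⟨av, hav⟩ := hv a
    obtain ⟨aw, haw⟩ := hw a
    obtain ⟨bv, hbv⟩ := hv b
    obtain ⟨bw, hbw⟩ := hw b
    -- The adjoint averages carry test vectors to test vectors, so the averaged field satisfies the
    -- same weak equations.
    have hM : ∀ {u φ φ'}, T.IsDeriv u φ φ' →
        T.IsDeriv u (T.avg (-w) ε (T.avg (-v) ε φ)) (T.avg (-w) ε (T.avg (-v) ε φ')) :=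
      fun h => (h.map _ fun y f => T.apply_avg y _ ε f).map _ fun y f => T.apply_avg y _ ε f
    have h1 : av + bw = 0 := T.eq_zero_of_forall_isDeriv v w _ fun φ φv φw hφv hφw => by
      rw [inner_add_left, hav.inner_eq hφv, hbw.inner_eq hφw, T.inner_avg_left, T.inner_avg_left,
        T.inner_avg_left, T.inner_avg_left, ← neg_add, hdiv _ _ _ (hM hφv) (hM hφw), neg_zero]
    have h2 : aw - bv = 0 := T.eq_zero_of_forall_isDeriv v w _ fun φ φv φw hφv hφw => by
      rw [inner_sub_left, haw.inner_eq hφw, hbv.inner_eq hφv, T.inner_avg_left, T.inner_avg_left,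
        T.inner_avg_left, T.inner_avg_left, neg_sub_neg, ← neg_sub,
        hcurl _ _ _ (hM hφv) (hM hφw), neg_zero]
    -- With `bw = -av` and `bv = aw`, this identity reads `-‖av‖² = ‖aw‖²`, which kills both
    -- derivatives.
    have h3 := hav.inner_comm haw hbv hbw
    rw [eq_neg_of_add_eq_zero_right h1, ← sub_eq_zero.1 h2, inner_neg_right,
      real_inner_self_eq_norm_sq, real_inner_self_eq_norm_sq] at h3
    have h4 : av = 0 := norm_eq_zero.1 (by nlinarith [sq_nonneg ‖av‖, sq_nonneg ‖aw‖])
    have h5 : aw = 0 := norm_eq_zero.1 (by nlinarith [sq_nonneg ‖av‖, sq_nonneg ‖aw‖])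
    subst h4 h5
    exact ⟨hav.apply_eq_self s, haw.apply_eq_self s⟩
  have hlim := T.tendsto_avg_avg v w a
  constructor
  · refine tendsto_nhds_unique (((T (s • v)).continuous.tendsto a).comp hlim) (hlim.congr fun ε => ?_)
    exact (key ε).1.symm
  · refine tendsto_nhds_unique (((T (s • w)).continuous.tendsto a).comp hlim) (hlim.congr fun ε => ?_)
    exact (key ε).2.symm

/-- The graph of the gradient in the directions `v 0`, `v 1`. -/
def gradGraph (v : Fin 2 → E) : Submodule ℝ (WithLp 2 (H × VecField H)) where
  carrier := {p | ∀ i, T.IsDeriv (v i) p.fst (p.snd i)}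
  add_mem' hp hq i := (hp i).add (hq i)
  zero_mem' _ := isDeriv_zero
  smul_mem' c _ hp i := (hp i).const_smul c

lemma isClosed_gradGraph [CompleteSpace H] (v : Fin 2 → E) :
    IsClosed (T.gradGraph v : Set (WithLp 2 (H × VecField H))) := by
  have : (T.gradGraph v : Set (WithLp 2 (H × VecField H))) =
      ⋂ i, (fun p : WithLp 2 (H × VecField H) => (p.fst, p.snd i)) ⁻¹'
        {p : H × H | T.IsDeriv (v i) p.1 p.2} := by
    ext p
    simp [gradGraph]
  rw [this]
  refine isClosed_iInter fun i => (isClosed_isDeriv (v i)).preimage ?_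
  fun_prop

/-- The space of gradients. -/
def grads (v : Fin 2 → E) : Submodule ℝ (VecField H) where
  carrier := {U | ∃ φ, ∀ i, T.IsDeriv (v i) φ (U i)}
  add_mem' := fun ⟨φ, hφ⟩ ⟨ψ, hψ⟩ => ⟨φ + ψ, fun i => (hφ i).add (hψ i)⟩
  zero_mem' := ⟨0, fun _ => isDeriv_zero⟩
  smul_mem' := fun c _ ⟨φ, hφ⟩ => ⟨c • φ, fun i => (hφ i).const_smul c⟩

/-- The weak form of "the curl of a gradient vanishes", equivalently of the determinant being a null
Lagrangian. -/
lemma inner_rot_grads {v : Fin 2 → E} {U V : VecField H} (hU : U ∈ T.grads v)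
    (hV : V ∈ T.grads v) : inner ℝ U (rot V) = 0 := by
  obtain ⟨φ, hφ⟩ := hU
  obtain ⟨ψ, hψ⟩ := hV
  rw [VecField.inner_eq, rot_apply_zero, rot_apply_one, inner_neg_right,
    (hφ 0).inner_comm (hφ 1) (hψ 0) (hψ 1), neg_add_cancel]

end UnitaryRep

lemma inner_eq_zero_of_mem_topologicalClosure {X : Type*} [NormedAddCommGroup X]
    [InnerProductSpace ℝ X] {M : Submodule ℝ X} {x : X} (h : ∀ y ∈ M, inner ℝ x y = 0) {y : X}
    (hy : y ∈ M.topologicalClosure) : inner ℝ x y = 0 :=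
  closure_minimal (s := (M : Set X)) (t := {y | inner ℝ x y = 0}) h
    (isClosed_eq (by fun_prop) continuous_const) hy

/-! ### Abstract homogenization: correctors, Weyl decomposition, duality. -/

open VecField

/-- The functional-analytic data of a stationary ergodic two-dimensional homogenization problem
whose coefficient `A` has determinant one, together with the weight `W` of the zeroth-order term. -/
structure DualSystem (E H : Type*) [NormedAddCommGroup E] [NormedSpace ℝ E]
    [NormedAddCommGroup H] [InnerProductSpace ℝ H] where
  T : UnitaryRep E H
  dir : Fin 2 → E
  one : H
  norm_one : ‖one‖ = 1
  apply_one : ∀ x, T x one = one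
  ergodic : ∀ f, (∀ i (s : ℝ), T (s • dir i) f = f) → ∃ c : ℝ, f = c • one
  A : VecField H →L[ℝ] VecField H
  symm : ∀ U V, inner ℝ (A U) V = inner ℝ U (A V)
  coer : ℝ
  coer_pos : 0 < coer
  coercive : ∀ U, coer * ‖U‖ ^ 2 ≤ inner ℝ (A U) U
  duality : ∀ U, A (rot (A U)) = rot U
  W : H →L[ℝ] H
  weight : ∀ u, ‖u‖ ^ 2 ≤ inner ℝ (W u) u

namespace DualSystem

variable {E H : Type*} [NormedAddCommGroup E] [NormedSpace ℝ E]
  [NormedAddCommGroup H] [InnerProductSpace ℝ H] (S : DualSystem E H)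

/-- The closure of the space of gradients. -/
def potentials : Submodule ℝ (VecField H) := (S.T.grads S.dir).topologicalClosure

lemma grads_le_potentials : S.T.grads S.dir ≤ S.potentials :=
  Submodule.le_topologicalClosure _

/-- `V` is the gradient of the corrector of the constant field `e`. -/
def IsCorrector (e : Fin 2 → ℝ) (V : VecField H) : Prop :=
  V ∈ S.potentials ∧ ∀ Φ ∈ S.T.grads S.dir, inner ℝ (S.A (const S.one e + V)) Φ = 0

/-- `p = (u, U)` solves the resolvent equation `(l - ℒ) u = 𝔻 · A e` weakly, with `U = 𝔻u`. -/
def IsResolvent (e : Fin 2 → ℝ) (l : ℝ) (p : WithLp 2 (H × VecField H)) : Prop :=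
  p ∈ S.T.gradGraph S.dir ∧ ∀ q ∈ S.T.gradGraph S.dir,
    l * inner ℝ (S.W p.fst) q.fst + inner ℝ (S.A p.snd) q.snd =
      -inner ℝ (S.A (const S.one e)) q.snd

variable {S} {e : Fin 2 → ℝ} {V : VecField H}

lemma IsCorrector.inner_eq_zero (hV : S.IsCorrector e V) {Φ : VecField H}
    (hΦ : Φ ∈ S.potentials) : inner ℝ (S.A (const S.one e + V)) Φ = 0 :=
  inner_eq_zero_of_mem_topologicalClosure hV.2 hΦ

variable (S)

/-- Without a zeroth-order term the form controls only the gradient, so the problem is posed on the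
closure of the gradients; the solution need not be the gradient of an element of `H`. -/
lemma exists_isCorrector [CompleteSpace H] (e : Fin 2 → ℝ) : ∃ V, S.IsCorrector e V := by
  have : CompleteSpace S.potentials :=
    (Submodule.isClosed_topologicalClosure _).completeSpace_coe
  obtain ⟨V, hV, h⟩ := exists_mem_forall_inner_eq S.potentials S.A S.coer_pos
    (fun u _ => S.coercive u) (-S.A (const S.one e))
  refine ⟨V, hV, fun Φ hΦ => ?_⟩
  rw [map_add, inner_add_left, h Φ (S.grads_le_potentials hΦ), inner_neg_left, add_neg_cancel]

/-- For `l > 0` the weighted zeroth-order term makes the form coercive in the full graph norm, with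
constant `min l S.coer`, and the graph of the gradient is closed. -/
lemma exists_isResolvent [CompleteSpace H] (e : Fin 2 → ℝ) {l : ℝ} (hl : 0 < l) :
    ∃ p, S.IsResolvent e l p := by
  have : CompleteSpace (S.T.gradGraph S.dir) :=
    (S.T.isClosed_gradGraph S.dir).completeSpace_coe
  let ι := (WithLp.prodContinuousLinearEquiv 2 ℝ H (VecField H))
  let B : WithLp 2 (H × VecField H) →L[ℝ] WithLp 2 (H × VecField H) :=
    (ι.symm : (H × VecField H) →L[ℝ] WithLp 2 (H × VecField H)) ∘L
      ((l • S.W).prodMap S.A) ∘L (ι : WithLp 2 (H × VecField H) →L[ℝ] (H × VecField H))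
  have hB : ∀ p q : WithLp 2 (H × VecField H), inner ℝ (B p) q =
      l * inner ℝ (S.W p.fst) q.fst + inner ℝ (S.A p.snd) q.snd := by
    intro p q
    rw [WithLp.prod_inner_apply, ← real_inner_smul_left]
    rfl
  obtain ⟨p, hp, h⟩ := exists_mem_forall_inner_eq (S.T.gradGraph S.dir) B
    (lt_min hl S.coer_pos) (fun p _ => by
      rw [hB, WithLp.prod_norm_sq_eq_of_L2, mul_add]
      have h1 := mul_le_mul_of_nonneg_left (S.weight p.fst) hl.le
      have h2 := S.coercive p.snd
      have h3 : min l S.coer * ‖p.fst‖ ^ 2 ≤ l * ‖p.fst‖ ^ 2 := by gcongr; exact min_le_left _ _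
      have h4 : min l S.coer * ‖p.snd‖ ^ 2 ≤ S.coer * ‖p.snd‖ ^ 2 := by
        gcongr; exact min_le_right _ _
      linarith) (ι.symm (0, -S.A (const S.one e)))
  refine ⟨p, hp, fun q hq => ?_⟩
  rw [← hB, h q hq, WithLp.prod_inner_apply]
  change inner ℝ (0 : H) q.fst + inner ℝ (-S.A (const S.one e)) q.snd = _
  rw [inner_zero_left, zero_add, inner_neg_left]

variable {S}

/-- The gradients of the solutions of the resolvent equation converge to the gradient of the
corrector. -/
lemma tendsto_of_isResolvent (hV : S.IsCorrector e V) {p : ℝ → WithLp 2 (H × VecField H)}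
    (hp : ∀ l, 0 < l → S.IsResolvent e l (p l)) :
    Tendsto (fun l => (p l).snd) (𝓝[>] 0) (𝓝 V) := by
  have hα := S.coer_pos
  set c := const S.one e with hc
  set R := ‖S.A c‖ / S.coer with hR
  have hR0 : 0 ≤ R := by positivity
  -- The resolvent equation tested with its own solution.
  have henergy : ∀ l, 0 < l → l * inner ℝ (S.W (p l).fst) (p l).fst +
      inner ℝ (S.A (p l).snd) (p l).snd ≤ ‖S.A c‖ * ‖(p l).snd‖ := fun l hl => by
    rw [(hp l hl).2 _ (hp l hl).1]
    exact (neg_le_abs _).trans (abs_real_inner_le_norm _ _)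
  have hU : ∀ l, 0 < l → ‖(p l).snd‖ ≤ R := fun l hl => by
    have h1 := henergy l hl
    have h2 := S.coercive (p l).snd
    have h3 : 0 ≤ l * inner ℝ (S.W (p l).fst) (p l).fst :=
      mul_nonneg hl.le ((sq_nonneg _).trans (S.weight _))
    rcases (norm_nonneg (p l).snd).eq_or_lt with h0 | h0
    · rw [← h0]; exact hR0
    · rw [hR, le_div_iff₀ hα]
      refine le_of_mul_le_mul_right ?_ h0
      nlinarith
  -- The energy estimate bounds `l ‖u‖²`, so the zeroth-order term `l u` is of order `√l` although
  -- `u` itself may blow up.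
  have hu : ∀ l, 0 < l → l * ‖(p l).fst‖ ≤ √l * √(‖S.A c‖ * R) := fun l hl => by
    have h1 := henergy l hl
    have h2 : 0 ≤ inner ℝ (S.A (p l).snd) (p l).snd :=
      (by positivity : 0 ≤ S.coer * ‖(p l).snd‖ ^ 2).trans (S.coercive _)
    have h3 := mul_le_mul_of_nonneg_left (S.weight (p l).fst) hl.le
    have h4 : ‖S.A c‖ * ‖(p l).snd‖ ≤ ‖S.A c‖ * R := by gcongr; exact hU l hl
    rw [← Real.sqrt_mul hl.le]
    refine Real.le_sqrt_of_sq_le ?_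
    calc (l * ‖(p l).fst‖) ^ 2 = l * (l * ‖(p l).fst‖ ^ 2) := by ring
      _ ≤ l * (‖S.A c‖ * R) := mul_le_mul_of_nonneg_left (by linarith) hl.le
  -- `V` is only a limit of gradients and is not an admissible test field, so it is compared with an
  -- arbitrary genuine gradient `q.snd`. The term `-l ⟨W u, u⟩` has a favourable sign and is
  -- dropped.
  have hmain : ∀ l, 0 < l → ∀ q ∈ S.T.gradGraph S.dir, S.coer * ‖(p l).snd - V‖ ^ 2 ≤
      √l * (√(‖S.A c‖ * R) * ‖S.W‖ * ‖q.fst‖) + ‖S.A‖ * (R + ‖V‖) * ‖q.snd - V‖ := by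
    intro l hl q hq
    set δ := (p l).snd - V with hδ
    have htest : ∀ r ∈ S.T.gradGraph S.dir,
        inner ℝ (S.A δ) r.snd = -(l * inner ℝ (S.W (p l).fst) r.fst) := by
      intro r hr
      have h1 := (hp l hl).2 r hr
      have h2 := hV.2 r.snd ⟨r.fst, hr⟩
      rw [map_add, inner_add_left] at h2
      rw [hδ, map_sub, inner_sub_left]
      linarith
    have hsplit : inner ℝ (S.A δ) δ = l * inner ℝ (S.W (p l).fst) q.fst -
        l * inner ℝ (S.W (p l).fst) (p l).fst + inner ℝ (S.A δ) (q.snd - V) := by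
      nth_rw 2 [hδ]
      rw [inner_sub_right, inner_sub_right, htest _ (hp l hl).1, htest _ hq]
      ring
    have h1 : 0 ≤ l * inner ℝ (S.W (p l).fst) (p l).fst :=
      mul_nonneg hl.le ((sq_nonneg _).trans (S.weight _))
    have h2 : l * inner ℝ (S.W (p l).fst) q.fst ≤ √l * (√(‖S.A c‖ * R) * ‖S.W‖ * ‖q.fst‖) := by
      calc l * inner ℝ (S.W (p l).fst) q.fst ≤ l * (‖S.W‖ * ‖(p l).fst‖ * ‖q.fst‖) := by
            gcongr
            refine (real_inner_le_norm _ _).trans ?_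
            gcongr
            exact S.W.le_opNorm _
        _ = (l * ‖(p l).fst‖) * (‖S.W‖ * ‖q.fst‖) := by ring
        _ ≤ (√l * √(‖S.A c‖ * R)) * (‖S.W‖ * ‖q.fst‖) :=
          mul_le_mul_of_nonneg_right (hu l hl) (by positivity)
        _ = _ := by ring
    have h3 : inner ℝ (S.A δ) (q.snd - V) ≤ ‖S.A‖ * (R + ‖V‖) * ‖q.snd - V‖ := by
      refine (real_inner_le_norm _ _).trans ?_
      gcongr
      refine (S.A.le_opNorm _).trans ?_
      gcongr
      exact (norm_sub_le _ _).trans (by gcongr; exact hU l hl)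
    have h4 := S.coercive δ
    linarith
  rw [tendsto_iff_norm_sub_tendsto_zero]
  have hsq : Tendsto (fun l => S.coer * ‖(p l).snd - V‖ ^ 2) (𝓝[>] 0) (𝓝 0) := by
    rw [Metric.tendsto_nhds]
    intro η hη
    set C := ‖S.A‖ * (R + ‖V‖) + 1 with hC
    have hC0 : 0 < C := by positivity
    -- The gradient is fixed before `l` tends to `0`: its distance to `V` costs at most `η / 2`, and
    -- the `√l` term is eventually below `η / 2`. The `+ 1` in `C` only keeps it positive.
    obtain ⟨Φ, ⟨φ, hφ⟩, hΦ⟩ := Metric.mem_closure_iff.1 hV.1 (η / (2 * C)) (by positivity)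
    let q : WithLp 2 (H × VecField H) := WithLp.toLp 2 (φ, Φ)
    have hq : q ∈ S.T.gradGraph S.dir := hφ
    have hlim : Tendsto (fun l : ℝ => √l * (√(‖S.A c‖ * R) * ‖S.W‖ * ‖q.fst‖)) (𝓝[>] 0) (𝓝 0) := by
      have : Tendsto (fun l : ℝ => √l) (𝓝[>] 0) (𝓝 0) := by
        simpa using (Real.continuous_sqrt.tendsto 0).mono_left nhdsWithin_le_nhds
      simpa using this.mul_const (√(‖S.A c‖ * R) * ‖S.W‖ * ‖q.fst‖)
    filter_upwards [hlim.eventually_lt_const (half_pos hη), self_mem_nhdsWithin] with l h1 hl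
    have h2 := hmain l hl q hq
    have h3 : ‖S.A‖ * (R + ‖V‖) * ‖q.snd - V‖ ≤ η / 2 := by
      have h4 : ‖q.snd - V‖ ≤ η / (2 * C) := by
        rw [← dist_eq_norm, dist_comm]; exact hΦ.le
      calc ‖S.A‖ * (R + ‖V‖) * ‖q.snd - V‖ ≤ C * (η / (2 * C)) := by gcongr; linarith
        _ = η / 2 := by field_simp
    rw [Real.dist_eq, sub_zero, abs_of_nonneg (by positivity)]
    linarith
  have h5 : Tendsto (fun l => √(S.coer⁻¹ * (S.coer * ‖(p l).snd - V‖ ^ 2))) (𝓝[>] 0) (𝓝 0) := by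
    simpa using (hsq.const_mul S.coer⁻¹).sqrt
  refine h5.congr fun l => ?_
  rw [inv_mul_cancel_left₀ hα.ne', Real.sqrt_sq (norm_nonneg _)]

lemma isDeriv_one (S : DualSystem E H) (v : E) : S.T.IsDeriv v S.one 0 := by
  simp only [UnitaryRep.IsDeriv, S.apply_one]
  exact hasDerivAt_const _ _

/-- Gradients have mean zero, by integration by parts against `one`, whose derivative vanishes;
density extends this to their closure. -/
lemma inner_const_potentials (S : DualSystem E H) (e : Fin 2 → ℝ) {Φ : VecField H}
    (hΦ : Φ ∈ S.potentials) : inner ℝ (const S.one e) Φ = 0 := by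
  refine inner_eq_zero_of_mem_topologicalClosure (M := S.T.grads S.dir) ?_ hΦ
  rintro U ⟨φ, hφ⟩
  have h : ∀ i, inner ℝ S.one (U i) = 0 := fun i => by
    have := (S.isDeriv_one (S.dir i)).inner_eq (hφ i)
    rw [inner_zero_left] at this
    linarith
  simp [VecField.inner_eq, real_inner_smul_left, h]

lemma inner_rot_potentials {U V : VecField H} (hU : U ∈ S.potentials) (hV : V ∈ S.potentials) :
    inner ℝ (rot U) V = 0 := by
  refine inner_eq_zero_of_mem_topologicalClosure (M := S.T.grads S.dir) (fun Φ hΦ => ?_) hV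
  rw [inner_rot_left, real_inner_comm, neg_eq_zero]
  refine inner_eq_zero_of_mem_topologicalClosure (M := S.T.grads S.dir) (fun Ψ hΨ => ?_) hU
  rw [inner_rot_left, S.T.inner_rot_grads hΦ hΨ, neg_zero]

lemma norm_const_single (S : DualSystem E H) (i : Fin 2) :
    ‖const S.one (Pi.single i 1)‖ ^ 2 = 1 := by
  rw [← real_inner_self_eq_norm_sq, VecField.inner_eq]
  fin_cases i <;> simp [S.norm_one]

/-- **Weyl decomposition**: a field orthogonal to all gradients is, up to a constant, a rotated
potential field. -/
lemma exists_rot_eq [CompleteSpace H] {q : VecField H}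
    (hq : ∀ Φ ∈ S.T.grads S.dir, inner ℝ q Φ = 0) :
    ∃ r ∈ S.potentials, ∃ b : Fin 2 → ℝ, rot q = r + const S.one b := by
  have : CompleteSpace S.potentials :=
    (Submodule.isClosed_topologicalClosure _).completeSpace_coe
  -- The remainder `w` is orthogonal to gradients by projection. It is also orthogonal to rotated
  -- gradients: `rot q` because `q` is orthogonal to gradients, `r` because it is a potential field.
  -- Liouville's theorem thus applies to `w`.
  set r := S.potentials.starProjection (rot q) with hr
  have hrmem : r ∈ S.potentials := Submodule.starProjection_apply_mem _ _
  set w := rot q - r with hw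
  have hw1 : ∀ Φ ∈ S.T.grads S.dir, inner ℝ w Φ = 0 := fun Φ hΦ =>
    Submodule.starProjection_inner_eq_zero _ Φ (S.grads_le_potentials hΦ)
  have hw2 : ∀ Φ ∈ S.T.grads S.dir, inner ℝ w (rot Φ) = 0 := fun Φ hΦ => by
    have h1 := inner_rot_potentials hrmem (S.grads_le_potentials hΦ)
    rw [inner_rot_left] at h1
    rw [hw, inner_sub_left, inner_rot_rot, hq Φ hΦ]
    linarith
  have hdiv : ∀ φ φv φw, S.T.IsDeriv (S.dir 0) φ φv → S.T.IsDeriv (S.dir 1) φ φw →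
      inner ℝ (w 0) φv + inner ℝ (w 1) φw = 0 := fun φ φv φw hv hw' => by
    have := hw1 (WithLp.toLp 2 ![φv, φw]) ⟨φ, fun i => by fin_cases i <;> simpa⟩
    simpa [VecField.inner_eq] using this
  have hcurl : ∀ φ φv φw, S.T.IsDeriv (S.dir 0) φ φv → S.T.IsDeriv (S.dir 1) φ φw →
      inner ℝ (w 0) φw - inner ℝ (w 1) φv = 0 := fun φ φv φw hv hw' => by
    have := hw2 (WithLp.toLp 2 ![φv, φw]) ⟨φ, fun i => by fin_cases i <;> simpa⟩
    simp [VecField.inner_eq] at this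
    linarith
  have h0 := fun s => S.T.apply_eq_self_of_weak hdiv hcurl s
  -- The field `(w 1, -w 0)` is again divergence- and curl-free, the two conditions being exchanged.
  have h1 := fun s => S.T.apply_eq_self_of_weak (a := w 1) (b := -w 0)
    (fun φ φv φw hv hw' => by
      have := hcurl φ φv φw hv hw'
      rw [inner_neg_left]
      linarith)
    (fun φ φv φw hv hw' => by
      have := hdiv φ φv φw hv hw'
      rw [inner_neg_left]
      linarith) s
  obtain ⟨c0, hc0⟩ := S.ergodic (w 0) fun i s => by
    fin_cases i
    exacts [(h0 s).1, (h0 s).2]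
  obtain ⟨c1, hc1⟩ := S.ergodic (w 1) fun i s => by
    fin_cases i
    exacts [(h1 s).1, (h1 s).2]
  refine ⟨r, hrmem, ![c0, c1], ?_⟩
  rw [← sub_eq_iff_eq_add', ← hw]
  ext i
  fin_cases i
  · simpa using hc0
  · simpa using hc1

/-- The homogenized coefficient for given corrector gradients. -/
def effective (S : DualSystem E H) (V : Fin 2 → VecField H) (i j : Fin 2) : ℝ :=
  inner ℝ (const S.one (Pi.single i 1) + V i) (S.A (const S.one (Pi.single j 1) + V j))

lemma effective_comm (V : Fin 2 → VecField H) (i j : Fin 2) :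
    S.effective V i j = S.effective V j i := by
  rw [effective, effective, ← S.symm, real_inner_comm]

/-- The flux is orthogonal to potential fields, so the corrector in the left factor drops out and
each entry is a mean flux. -/
lemma effective_eq {V : Fin 2 → VecField H} (hV : ∀ i, S.IsCorrector (Pi.single i 1) (V i))
    (i j : Fin 2) : S.effective V i j =
      inner ℝ (const S.one (Pi.single i 1)) (S.A (const S.one (Pi.single j 1) + V j)) := by
  have := (hV j).inner_eq_zero (hV i).1
  rw [real_inner_comm] at this
  rw [effective, inner_add_left, this, add_zero]

/-- **Keller–Dykhne duality**: the homogenized matrix has determinant one. -/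
theorem effective_det [CompleteSpace H] {V : Fin 2 → VecField H}
    (hV : ∀ i, S.IsCorrector (Pi.single i 1) (V i)) :
    S.effective V 0 0 * S.effective V 1 1 - S.effective V 0 1 * S.effective V 1 0 = 1 := by
  set c : Fin 2 → VecField H := fun i => const S.one (Pi.single i 1) with hc
  set q := S.A (c 0 + V 0) with hq
  obtain ⟨r, hr, b, hb⟩ := exists_rot_eq (S := S) (q := q) (hV 0).2
  have hbc : const S.one b = b 0 • c 0 + b 1 • c 1 := by
    ext i; fin_cases i <;> simp [hc]
  have hcc : ∀ i, inner ℝ (c i) (const S.one b) = b i := fun i => by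
    rw [VecField.inner_eq]
    fin_cases i <;> simp [hc, inner_smul_right, S.norm_one]
  -- `b` is the mean of `rot q`, since `r` has mean zero.
  have hbi : ∀ i, b i = -inner ℝ (rot (c i)) q := fun i => by
    rw [inner_rot_left, neg_neg, hb, inner_add_right, S.inner_const_potentials _ hr, zero_add, hcc]
  have hb0 : b 0 = -S.effective V 1 0 := by
    rw [hbi, effective_eq hV, hc, rot_const_zero]
  have hb1 : b 1 = S.effective V 0 0 := by
    rw [hbi, effective_eq hV, hc, rot_const_one, inner_neg_left, neg_neg]
  -- Symmetry and duality reduce the left side to `⟨rot (c 0 + V 0), c 1 + V 1⟩`; only `⟨rot (c 0),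
  -- c 1⟩ = 1` survives.
  have h1 : inner ℝ (rot q) (S.A (c 1 + V 1)) = 1 := by
    have e1 := inner_rot_potentials (hV 0).1 (hV 1).1
    have e2 := S.inner_const_potentials (Pi.single 1 1) (hV 1).1
    have e3 := S.inner_const_potentials (Pi.single 0 1) (hV 0).1
    have e4 := S.norm_const_single 1
    simp only [← S.symm, hq, S.duality, map_add, inner_add_left, inner_add_right, e1, hc,
      inner_rot_left (V 0), rot_const_zero, rot_const_one, e2,
      real_inner_comm _ (V 0), real_inner_self_eq_norm_sq, e4]
    norm_num
    exact e3
  have h2 : inner ℝ r (S.A (c 1 + V 1)) = 0 := by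
    rw [real_inner_comm]; exact (hV 1).inner_eq_zero hr
  rw [hb, inner_add_left, h2, hbc, inner_add_left, real_inner_smul_left, real_inner_smul_left,
    ← effective_eq hV, ← effective_eq hV, hb0, hb1] at h1
  linarith

/-- The homogenized matrix is bounded by the average of the coefficient. -/
lemma effective_le {V : Fin 2 → VecField H} (hV : ∀ i, S.IsCorrector (Pi.single i 1) (V i))
    (x : Fin 2 → ℝ) : ∑ i, ∑ j, x i * x j * S.effective V i j ≤
      inner ℝ (const S.one x) (S.A (const S.one x)) := by
  set c : Fin 2 → VecField H := fun i => const S.one (Pi.single i 1) with hc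
  set U := x 0 • V 0 + x 1 • V 1 with hU
  have hxc : const S.one x = x 0 • c 0 + x 1 • c 1 := by
    ext i; fin_cases i <;> simp [hc]
  have hUmem : U ∈ S.potentials :=
    add_mem (Submodule.smul_mem _ _ (hV 0).1) (Submodule.smul_mem _ _ (hV 1).1)
  have hsum : const S.one x + U = x 0 • (c 0 + V 0) + x 1 • (c 1 + V 1) := by
    rw [hxc, hU]; module
  have horth : inner ℝ (S.A (const S.one x + U)) U = 0 := by
    rw [hsum, map_add, map_smul, map_smul, inner_add_left, real_inner_smul_left,
      real_inner_smul_left, (hV 0).inner_eq_zero hUmem, (hV 1).inner_eq_zero hUmem]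
    simp
  have hlhs : ∑ i, ∑ j, x i * x j * S.effective V i j =
      inner ℝ (const S.one x + U) (S.A (const S.one x + U)) := by
    rw [hsum]
    simp only [map_add, map_smul, inner_add_left (𝕜 := ℝ) (x 0 • _),
      inner_add_right (𝕜 := ℝ) _ (x 0 • _), real_inner_smul_left, inner_smul_right,
      Fin.sum_univ_two, effective]
    simp only [hc]
    ring
  rw [hlhs]
  -- The constant field is a competitor in the minimization solved by the correctors; by
  -- orthogonality its excess energy is exactly that of `U`.
  have h1 : inner ℝ (const S.one x) (S.A (const S.one x)) =
      inner ℝ (const S.one x + U) (S.A (const S.one x + U)) + inner ℝ (S.A U) U := by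
    have h2 : inner ℝ (const S.one x) (S.A U) = inner ℝ (S.A (const S.one x)) U :=
      (S.symm _ _).symm
    rw [inner_add_left, real_inner_comm _ U, horth, add_zero, map_add, inner_add_right, h2]
    rw [map_add, inner_add_left] at horth
    linarith
  rw [h1]
  have h4 : 0 ≤ inner ℝ (S.A U) U :=
    (mul_nonneg S.coer_pos.le (sq_nonneg _)).trans (S.coercive U)
  linarith

end DualSystem

/-! ### The topology of `Ω` and the Koopman representation. -/

namespace SurfaceSpace

variable {d : ℕ}

lemma isInducing_jet : IsInducing (fun (h : SurfaceSpace d) (k : Fin 4) => jet k h) :=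
  inducing_iInf_to_pi _

instance (k : ℕ) : SecondCountableTopology (EuclideanSpace ℝ (Fin d) [×k]→L[ℝ] ℝ) := by
  have : FiniteDimensional ℝ (EuclideanSpace ℝ (Fin d) [×k]→L[ℝ] ℝ) :=
    Module.Finite.of_injective
      (ContinuousMultilinearMap.toMultilinearMapLinear : (EuclideanSpace ℝ (Fin d) [×k]→L[ℝ] ℝ)
        →ₗ[ℝ] MultilinearMap ℝ (fun _ : Fin k => EuclideanSpace ℝ (Fin d)) ℝ)
      ContinuousMultilinearMap.toMultilinearMap_injective
  have : ProperSpace (EuclideanSpace ℝ (Fin d) [×k]→L[ℝ] ℝ) := FiniteDimensional.proper_real _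
  infer_instance

/-- With second countability, Borel sets of products with `Ω` come from the product σ-algebra, which
makes translation jointly measurable. Pseudometrizability, shown next, makes finite measures weakly
regular, so bounded continuous functions are dense in `L²(P)`. -/
instance : SecondCountableTopology (SurfaceSpace d) := isInducing_jet.secondCountableTopology

instance : TopologicalSpace.PseudoMetrizableSpace (SurfaceSpace d) :=
  isInducing_jet.pseudoMetrizableSpace

lemma jet_translate (k : Fin 4) (x : EuclideanSpace ℝ (Fin d)) (h : SurfaceSpace d) :
    jet k (translate x h) = (jet k h).comp ⟨fun y => y + x, by fun_prop⟩ := by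
  ext1 y
  exact iteratedFDeriv_comp_add_right k x y

lemma translate_zero (h : SurfaceSpace d) : translate 0 h = h := by
  cases h
  simp [translate]

lemma translate_translate (x y : EuclideanSpace ℝ (Fin d)) (h : SurfaceSpace d) :
    translate x (translate y h) = translate (x + y) h := by
  simp only [translate, SurfaceSpace.mk.injEq]
  funext z
  rw [add_assoc]

lemma continuous_translate :
    Continuous fun p : EuclideanSpace ℝ (Fin d) × SurfaceSpace d => translate p.1 p.2 := by
  rw [isInducing_jet.continuous_iff, continuous_pi_iff]
  intro k
  simp only [Function.comp_def, jet_translate]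
  refine Continuous.compCM ?_ ?_
  · exact ((continuous_apply k).comp isInducing_jet.continuous).comp continuous_snd
  · refine ContinuousMap.continuous_of_continuous_uncurry _ ?_
    exact continuous_snd.add (continuous_fst.comp continuous_fst)

lemma continuous_translate_left (h : SurfaceSpace d) :
    Continuous fun x : EuclideanSpace ℝ (Fin d) => translate x h :=
  continuous_translate.comp (by fun_prop : Continuous fun x => (x, h))

lemma measurable_translate_uncurry :
    Measurable fun p : EuclideanSpace ℝ (Fin d) × SurfaceSpace d => translate p.1 p.2 :=
  continuous_translate.measurable

lemma measurable_translate (x : EuclideanSpace ℝ (Fin d)) :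
    Measurable (translate x : SurfaceSpace d → SurfaceSpace d) :=
  (continuous_translate.comp (by fun_prop : Continuous fun h => (x, h))).measurable

variable {P : Measure (SurfaceSpace d)}

lemma IsStationary.measurePreserving (hA : IsStationary P) (x : EuclideanSpace ℝ (Fin d)) :
    MeasurePreserving (translate x) P P :=
  ⟨measurable_translate x, by
    ext B hB
    rw [Measure.map_apply (measurable_translate x) hB, hA B hB x]⟩

/-- Dominated convergence in `L²` along a countably generated filter. -/
lemma tendsto_eLpNorm_of_dominated {Ω ι : Type*} [MeasurableSpace Ω] {P : Measure Ω}
    [IsFiniteMeasure P] {l : Filter ι} [l.IsCountablyGenerated] {F : ι → Ω → ℝ} {C : ℝ}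
    (hmeas : ∀ᶠ i in l, AEStronglyMeasurable (F i) P)
    (hbound : ∀ᶠ i in l, ∀ᵐ ω ∂P, |F i ω| ≤ C)
    (hlim : ∀ᵐ ω ∂P, Tendsto (fun i => F i ω) l (𝓝 0)) :
    Tendsto (fun i => eLpNorm (F i) 2 P) l (𝓝 0) := by
  have key : Tendsto (fun i => ∫⁻ ω, ‖F i ω‖ₑ ^ (2 : ℝ) ∂P) l (𝓝 (∫⁻ _, 0 ∂P)) := by
    refine tendsto_lintegral_filter_of_dominated_convergence'
      (fun _ => ENNReal.ofReal C ^ (2 : ℝ)) ?_ ?_ ?_ ?_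
    · filter_upwards [hmeas] with i hi
      exact hi.enorm.pow_const _
    · filter_upwards [hbound] with i hi
      filter_upwards [hi] with ω hω
      gcongr
      rw [Real.enorm_eq_ofReal_abs]
      exact ENNReal.ofReal_le_ofReal hω
    · rw [lintegral_const]
      finiteness
    · filter_upwards [hlim] with ω hω
      have h1 : Tendsto (fun i => ‖F i ω‖ₑ) l (𝓝 0) := by
        simpa [Function.comp_def] using (continuous_enorm.tendsto (0 : ℝ)).comp hω
      simpa [Function.comp_def] using (ENNReal.continuous_rpow_const (y := 2)).tendsto 0 |>.comp h1
  rw [lintegral_zero] at key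
  have h2 := ((ENNReal.continuous_rpow_const (y := 1 / 2)).tendsto 0).comp key
  simp only [Function.comp_def] at h2
  rw [ENNReal.zero_rpow_of_pos (by norm_num)] at h2
  refine h2.congr fun i => ?_
  rw [eLpNorm_eq_lintegral_rpow_enorm_toReal (by norm_num) (by norm_num)]
  simp

section Koopman

variable [IsProbabilityMeasure P]

/-- The action of a translation on `L²(P)`. -/
def koopman (hA : IsStationary P) (x : EuclideanSpace ℝ (Fin d)) : Lp ℝ 2 P →ₗᵢ[ℝ] Lp ℝ 2 P :=
  Lp.compMeasurePreservingₗᵢ ℝ (translate x) (hA.measurePreserving x)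

lemma koopman_toLp (hA : IsStationary P) (x : EuclideanSpace ℝ (Fin d)) {f : SurfaceSpace d → ℝ}
    (hf : MemLp f 2 P) : koopman hA x (hf.toLp f) =
      (hf.comp_measurePreserving (hA.measurePreserving x)).toLp (fun h => f (translate x h)) :=
  Lp.toLp_compMeasurePreserving hf (hA.measurePreserving x)

lemma coeFn_koopman (hA : IsStationary P) (x : EuclideanSpace ℝ (Fin d)) (f : Lp ℝ 2 P) :
    koopman hA x f =ᵐ[P] fun h => f (translate x h) :=
  Lp.coeFn_compMeasurePreserving f (hA.measurePreserving x)

/-- For bounded continuous observables this is dominated convergence along the continuous orbits `x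
↦ translate x h`; density and the isometry property give the general case. -/
lemma continuous_koopman (hA : IsStationary P) (f : Lp ℝ 2 P) :
    Continuous fun x => koopman hA x f := by
  let S : Set (Lp ℝ 2 P) := {f | Continuous fun x => koopman hA x f}
  have hclosed : IsClosed S := by
    refine isClosed_of_closure_subset fun f hf => ?_
    refine Metric.continuous_iff.2 fun x ε hε => ?_
    obtain ⟨g, hg, hfg⟩ := Metric.mem_closure_iff.1 hf (ε / 3) (by positivity)
    obtain ⟨δ, hδ, h⟩ := Metric.continuous_iff.1 hg x (ε / 3) (by positivity)
    refine ⟨δ, hδ, fun y hy => ?_⟩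
    have h1 : dist (koopman hA y f) (koopman hA y g) < ε / 3 := by
      rwa [(koopman hA y).isometry.dist_eq]
    have h2 : dist (koopman hA x g) (koopman hA x f) < ε / 3 := by
      rwa [(koopman hA x).isometry.dist_eq, dist_comm]
    calc dist (koopman hA y f) (koopman hA x f)
        ≤ dist (koopman hA y f) (koopman hA y g) + dist (koopman hA y g) (koopman hA x g) +
          dist (koopman hA x g) (koopman hA x f) := dist_triangle4 _ _ _ _
      _ < ε / 3 + ε / 3 + ε / 3 := by gcongr; exact h y hy
      _ = ε := by ring
  have hdense : Dense S := by
    refine (BoundedContinuousFunction.toLp_denseRange ℝ P ℝ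
      (p := 2) (by norm_num)).mono ?_
    rintro _ ⟨g, rfl⟩
    refine continuous_iff_continuousAt.2 fun x => ?_
    have hg : MemLp g 2 P := MemLp.of_bound g.continuous.aestronglyMeasurable ‖g‖
      (Eventually.of_forall g.norm_coe_le_norm)
    have e : BoundedContinuousFunction.toLp 2 P ℝ g = hg.toLp g :=
      Lp.ext ((BoundedContinuousFunction.coeFn_toLp 2 P ℝ g).trans hg.coeFn_toLp.symm)
    rw [ContinuousAt, Lp.tendsto_Lp_iff_tendsto_eLpNorm']
    have hdom : Tendsto (fun y => eLpNorm (fun h => g (translate y h) - g (translate x h)) 2 P)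
        (𝓝 x) (𝓝 0) := by
      refine tendsto_eLpNorm_of_dominated (C := ‖g‖ + ‖g‖) (Eventually.of_forall fun y => ?_)
        (Eventually.of_forall fun y => Eventually.of_forall fun h => ?_)
        (Eventually.of_forall fun h => ?_)
      · exact ((g.continuous.measurable.comp (measurable_translate y)).sub
          (g.continuous.measurable.comp (measurable_translate x))).aestronglyMeasurable
      · exact (norm_sub_le _ _).trans (add_le_add (g.norm_coe_le_norm _) (g.norm_coe_le_norm _))
      · have := (g.continuous.comp (continuous_translate_left h)).tendsto x
        simpa using this.sub_const (g (translate x h))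
    refine hdom.congr fun y => eLpNorm_congr_ae ?_
    rw [e, koopman_toLp, koopman_toLp]
    filter_upwards [MemLp.coeFn_toLp (hg.comp_measurePreserving (hA.measurePreserving x)),
      MemLp.coeFn_toLp (hg.comp_measurePreserving (hA.measurePreserving y))] with h h1 h2
    exact (congrArg₂ (· - ·) h2 h1).symm
  have : f ∈ S := by
    rw [← hclosed.closure_eq]; exact hdense f
  exact this

/-- The translations as a strongly continuous unitary representation on `L²(P)`. -/
def koopmanRep (hA : IsStationary P) : UnitaryRep (EuclideanSpace ℝ (Fin d)) (Lp ℝ 2 P) where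
  toFun := koopman hA
  zero_apply f := by
    refine Lp.ext ((coeFn_koopman hA 0 f).trans (Eventually.of_forall fun h => ?_))
    simp only [translate_zero]
  add_apply x y f := by
    refine Lp.ext ?_
    have h1 := (hA.measurePreserving x).quasiMeasurePreserving.ae_eq (coeFn_koopman hA y f)
    filter_upwards [coeFn_koopman hA (x + y) f, coeFn_koopman hA x (koopman hA y f), h1]
      with h e1 e2 e3
    simp only [Function.comp_apply, translate_translate] at e3
    rw [e1, e2, e3, add_comm]
  continuous_orbit := continuous_koopman hA

lemma hasL2Deriv_iff (hA : IsStationary P) {i : Fin d} {f f' : SurfaceSpace d → ℝ} :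
    HasL2Deriv P i f f' ↔ ∃ (hf : MemLp f 2 P) (hf' : MemLp f' 2 P),
      (koopmanRep hA).IsDeriv (EuclideanSpace.single i 1) (hf.toLp f) (hf'.toLp f') := by
  rw [HasL2Deriv, ← exists_prop]
  refine exists_congr fun hf => ?_
  rw [← exists_prop]
  refine exists_congr fun hf' => ?_
  rw [UnitaryRep.isDeriv_iff_tendsto, Lp.tendsto_Lp_iff_tendsto_eLpNorm']
  refine tendsto_congr fun s => eLpNorm_congr_ae ?_
  have e0 : s • EuclideanSpace.single i (1 : ℝ) = EuclideanSpace.single i s := by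
    ext j
    simp
  have e1 : (koopmanRep hA).toFun (s • EuclideanSpace.single i 1) (hf.toLp f) =
      (hf.comp_measurePreserving (hA.measurePreserving (EuclideanSpace.single i s))).toLp
        (fun h => f (translate (EuclideanSpace.single i s) h)) := by
    rw [e0]; exact koopman_toLp hA _ hf
  rw [e1, ← MemLp.toLp_sub, ← MemLp.toLp_const_smul]
  filter_upwards [MemLp.coeFn_toLp (((hf.comp_measurePreserving
    (hA.measurePreserving (EuclideanSpace.single i s))).sub hf).const_smul s⁻¹), hf'.coeFn_toLp]
    with h h1 h2
  simp only [Pi.sub_apply, h2]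
  erw [h1]
  simp [div_eq_inv_mul]

end Koopman

end SurfaceSpace

/-! ### Ergodicity and multiplication operators on `L²(P)`. -/

namespace SurfaceSpace

variable {d : ℕ} {P : Measure (SurfaceSpace d)}

/-- An almost surely invariant measurable function is almost surely constant. -/
lemma IsErgodicField.ae_eq_const [IsProbabilityMeasure P] (hB : IsErgodicField P)
    {g : SurfaceSpace d → ℝ} (hg : Measurable g)
    (hinv : ∀ x, ∀ᵐ h ∂P, g (translate x h) = g h) : ∃ c : ℝ, g =ᵐ[P] fun _ => c := by
  -- Fubini replaces the null set depending on `x` by one null set of surfaces `h`, at the price of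
  -- "almost every `x`".
  have hswap : ∀ᵐ h ∂P, ∀ᵐ x : EuclideanSpace ℝ (Fin d), g (translate x h) = g h := by
    refine (Measure.ae_ae_comm (μ := (volume : Measure (EuclideanSpace ℝ (Fin d))))
      (p := fun x h => g (translate x h) = g h) ?_).1 (Eventually.of_forall hinv)
    exact measurableSet_eq_fun (hg.comp measurable_translate_uncurry) (hg.comp measurable_snd)
  refine exists_eventuallyEq_const_of_forall_separating MeasurableSet fun U hU => ?_
  -- The ergodicity hypothesis concerns strictly invariant sets. Asking for almost every translate
  -- makes `B` exactly invariant, as Lebesgue measure is invariant, while `B` agrees with `g ⁻¹' U`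
  -- almost surely.
  set B : Set (SurfaceSpace d) :=
    {h | ∀ᵐ x : EuclideanSpace ℝ (Fin d), g (translate x h) ∈ U} with hBdef
  have hmeas : MeasurableSet B := by
    have h1 : MeasurableSet {p : SurfaceSpace d × EuclideanSpace ℝ (Fin d) |
        g (translate p.2 p.1) ∉ U} :=
      ((hg.comp measurable_translate_uncurry).comp measurable_swap) hU.compl
    exact measurable_measure_prodMk_left (ν := volume) h1 (measurableSet_singleton 0)
  have hsub : ∀ (y : EuclideanSpace ℝ (Fin d)) (h), h ∈ B → translate y h ∈ B := by
    intro y h hh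
    have := (measurePreserving_add_right volume y).quasiMeasurePreserving.ae hh
    filter_upwards [this] with x hx
    rwa [translate_translate]
  have hinvB : ∀ y : EuclideanSpace ℝ (Fin d), translate y '' B = B := by
    intro y
    refine Set.Subset.antisymm (Set.image_subset_iff.2 (hsub y)) fun h hh => ?_
    refine ⟨translate (-y) h, hsub _ _ hh, ?_⟩
    rw [translate_translate, add_neg_cancel, translate_zero]
  have hiff : ∀ᵐ h ∂P, (h ∈ B ↔ g h ∈ U) := by
    filter_upwards [hswap] with h hh
    rw [hBdef, Set.mem_ofPred_eq, ← eventually_const (f := ae (volume :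
      Measure (EuclideanSpace ℝ (Fin d)))) (p := g h ∈ U)]
    refine eventually_congr ?_
    filter_upwards [hh] with x hx
    rw [hx]
  rcases hB B hmeas hinvB with h0 | h1
  · right
    filter_upwards [hiff, measure_eq_zero_iff_ae_notMem.1 h0] with h e1 e2
    rwa [← e1]
  · left
    filter_upwards [hiff, (mem_ae_iff_prob_eq_one hmeas).2 h1] with h e1 e2
    exact e1.1 e2

variable [IsProbabilityMeasure P]

/-- The constant function one as an element of `L²(P)`. -/
def oneL2 (P : Measure (SurfaceSpace d)) [IsProbabilityMeasure P] : Lp ℝ 2 P :=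
  (memLp_const (1 : ℝ)).toLp fun _ => 1

lemma coeFn_oneL2 : oneL2 P =ᵐ[P] fun _ => 1 := MemLp.coeFn_toLp _

lemma norm_oneL2 : ‖oneL2 P‖ = 1 := by
  rw [oneL2, Lp.norm_toLp, eLpNorm_const' _ (by norm_num) (by norm_num)]
  simp

lemma koopman_oneL2 (hA : IsStationary P) (x : EuclideanSpace ℝ (Fin d)) :
    koopman hA x (oneL2 P) = oneL2 P :=
  koopman_toLp hA x _

lemma IsErgodicField.exists_eq_smul_oneL2 (hA : IsStationary P) (hB : IsErgodicField P)
    (f : Lp ℝ 2 P) (hf : ∀ x, koopman hA x f = f) : ∃ c : ℝ, f = c • oneL2 P := by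
  obtain ⟨c, hc⟩ := hB.ae_eq_const (Lp.stronglyMeasurable f).measurable fun x => by
    filter_upwards [coeFn_koopman hA x f] with h hh
    rw [← hh, hf x]
  refine ⟨c, Lp.ext ?_⟩
  filter_upwards [hc, Lp.coeFn_smul c (oneL2 P), coeFn_oneL2 (P := P)] with h h1 h2 h3
  rw [h1, h2, Pi.smul_apply, h3, smul_eq_mul, mul_one]

lemma memLp_bdd_mul {Ω : Type*} [MeasurableSpace Ω] {P : Measure Ω} {a f : Ω → ℝ}
    (ha : AEStronglyMeasurable a P) {C : ℝ} (hC : ∀ᵐ ω ∂P, ‖a ω‖ ≤ C) (hf : MemLp f 2 P) :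
    MemLp (fun ω => a ω * f ω) 2 P :=
  hf.of_le_mul (ha.mul hf.1) (c := C) (by
    filter_upwards [hC] with ω h
    rw [norm_mul]
    gcongr)

/-- Multiplication by a bounded measurable function on `L²`. -/
def mulL2 {Ω : Type*} [MeasurableSpace Ω] {P : Measure Ω} (a : Ω → ℝ)
    (ha : AEStronglyMeasurable a P) (C : ℝ) (hC : ∀ᵐ ω ∂P, ‖a ω‖ ≤ C) : Lp ℝ 2 P →L[ℝ] Lp ℝ 2 P :=
  have hmem : ∀ f : Lp ℝ 2 P, MemLp (fun ω => a ω * f ω) 2 P := fun f =>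
    memLp_bdd_mul ha hC (Lp.memLp f)
  LinearMap.mkContinuous
    { toFun := fun f => (hmem f).toLp _
      map_add' := fun f g => by
        rw [← MemLp.toLp_add]
        refine (MemLp.toLp_eq_toLp_iff _ _).2 ?_
        filter_upwards [Lp.coeFn_add f g] with ω h
        change a ω * (f + g : Lp ℝ 2 P) ω = a ω * f ω + a ω * g ω
        rw [h, Pi.add_apply, mul_add]
      map_smul' := fun c f => by
        rw [RingHom.id_apply, ← MemLp.toLp_const_smul]
        refine (MemLp.toLp_eq_toLp_iff _ _).2 ?_
        filter_upwards [Lp.coeFn_smul c f] with ω h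
        change a ω * (c • f : Lp ℝ 2 P) ω = c * (a ω * f ω)
        rw [h, Pi.smul_apply, smul_eq_mul, mul_left_comm] } C fun f => by
    refine Lp.norm_le_mul_norm_of_ae_le_mul ?_
    filter_upwards [(hmem f).coeFn_toLp, hC] with ω h1 h2
    simp only [LinearMap.coe_mk, AddHom.coe_mk]
    rw [h1, norm_mul]
    gcongr

lemma coeFn_mulL2 {Ω : Type*} [MeasurableSpace Ω] {P : Measure Ω} {a : Ω → ℝ}
    (ha : AEStronglyMeasurable a P) {C : ℝ} (hC : ∀ᵐ ω ∂P, ‖a ω‖ ≤ C) (f : Lp ℝ 2 P) :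
    mulL2 a ha C hC f =ᵐ[P] fun ω => a ω * f ω :=
  MemLp.coeFn_toLp (memLp_bdd_mul ha hC (Lp.memLp f))

end SurfaceSpace

/-! ### Algebra of `√|g| g⁻¹` in dimension two. -/

/-- The determinant of `I + v ⊗ v` for `v ∈ ℝ²`. -/
def gramDet (v : EuclideanSpace ℝ (Fin 2)) : ℝ := 1 + v 0 ^ 2 + v 1 ^ 2

lemma one_le_gramDet (v : EuclideanSpace ℝ (Fin 2)) : 1 ≤ gramDet v := by
  rw [gramDet]; nlinarith [sq_nonneg (v 0), sq_nonneg (v 1)]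

lemma gramDet_pos (v : EuclideanSpace ℝ (Fin 2)) : 0 < gramDet v :=
  zero_lt_one.trans_le (one_le_gramDet v)

lemma gramDet_eq (v : EuclideanSpace ℝ (Fin 2)) : gramDet v = 1 + ‖v‖ ^ 2 := by
  rw [EuclideanSpace.real_norm_sq_eq, Fin.sum_univ_two, gramDet, add_assoc]

/-- The coefficient `√|g| g⁻¹`, as a function of the slope. -/
def slopeCoef (v : EuclideanSpace ℝ (Fin 2)) : Matrix (Fin 2) (Fin 2) ℝ :=
  (√(gramDet v))⁻¹ • !![1 + v 1 ^ 2, -(v 0 * v 1); -(v 0 * v 1), 1 + v 0 ^ 2]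

lemma det_metric_of_slope (v : EuclideanSpace ℝ (Fin 2)) :
    (1 + Matrix.vecMulVec (fun i => v i) (fun j => v j)).det = gramDet v := by
  simp [Matrix.det_fin_two, Matrix.vecMulVec_apply, gramDet]
  ring

lemma sqrt_mul_inv_of_slope (v : EuclideanSpace ℝ (Fin 2)) (i j : Fin 2) :
    √(gramDet v) * (1 + Matrix.vecMulVec (fun i => v i) (fun j => v j))⁻¹ i j =
      slopeCoef v i j := by
  have h1 : √(gramDet v) * (gramDet v)⁻¹ = (√(gramDet v))⁻¹ := by
    have h := Real.mul_self_sqrt (gramDet_pos v).le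
    have h' := Real.sqrt_pos.2 (gramDet_pos v)
    nth_rw 2 [← h]
    field_simp
  rw [Matrix.inv_def, det_metric_of_slope, Ring.inverse_eq_inv', Matrix.smul_apply, smul_eq_mul,
    ← mul_assoc, h1, slopeCoef, Matrix.smul_apply, smul_eq_mul, Matrix.adjugate_fin_two]
  congr 1
  fin_cases i <;> fin_cases j <;> simp [Matrix.vecMulVec_apply] <;> ring

/-- In dimension two the factor `√|g|` contributes `|g|` to the determinant, which cancels `det
g⁻¹`. -/
lemma slopeCoef_det (v : EuclideanSpace ℝ (Fin 2)) :
    slopeCoef v 0 0 * slopeCoef v 1 1 - slopeCoef v 0 1 * slopeCoef v 0 1 = 1 := by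
  have h : (√(gramDet v))⁻¹ * (√(gramDet v))⁻¹ = (gramDet v)⁻¹ := by
    rw [← mul_inv, Real.mul_self_sqrt (gramDet_pos v).le]
  have h2 : (gramDet v)⁻¹ * gramDet v = 1 := inv_mul_cancel₀ (gramDet_pos v).ne'
  have h3 : gramDet v = 1 + v 0 ^ 2 + v 1 ^ 2 := rfl
  simp only [slopeCoef, Matrix.smul_apply, Matrix.of_apply, Matrix.cons_val', Matrix.cons_val_zero,
    Matrix.cons_val_one, Matrix.cons_val_fin_one, smul_eq_mul]
  generalize (√(gramDet v))⁻¹ = r at *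
  rw [h3] at h2 h
  linear_combination h2 + h * (1 + v 0 ^ 2 + v 1 ^ 2)

/-- The adjugate of `I + v ⊗ v` is `I` plus the square of the component across `v`; both ellipticity
bounds are read off from this sum of squares. -/
lemma slopeCoef_quadratic (v : EuclideanSpace ℝ (Fin 2)) (x y : ℝ) :
    x * (slopeCoef v 0 0 * x + slopeCoef v 0 1 * y) +
      y * (slopeCoef v 0 1 * x + slopeCoef v 1 1 * y) =
      (√(gramDet v))⁻¹ * (x ^ 2 + y ^ 2 + (x * v 1 - y * v 0) ^ 2) := by
  simp only [slopeCoef, Matrix.smul_apply, Matrix.of_apply, Matrix.cons_val', Matrix.cons_val_zero,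
    Matrix.cons_val_one, Matrix.cons_val_fin_one, smul_eq_mul]
  ring

lemma le_slopeCoef_quadratic (v : EuclideanSpace ℝ (Fin 2)) (x y : ℝ) :
    (√(gramDet v))⁻¹ * (x ^ 2 + y ^ 2) ≤ x * (slopeCoef v 0 0 * x + slopeCoef v 0 1 * y) +
      y * (slopeCoef v 0 1 * x + slopeCoef v 1 1 * y) := by
  rw [slopeCoef_quadratic]
  exact mul_le_mul_of_nonneg_left (by nlinarith [sq_nonneg (x * v 1 - y * v 0)]) (by positivity)

lemma slopeCoef_quadratic_le (v : EuclideanSpace ℝ (Fin 2)) (x y : ℝ) :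
    x * (slopeCoef v 0 0 * x + slopeCoef v 0 1 * y) +
      y * (slopeCoef v 0 1 * x + slopeCoef v 1 1 * y) ≤ √(gramDet v) * (x ^ 2 + y ^ 2) := by
  have h' := Real.sqrt_pos.2 (gramDet_pos v)
  rw [slopeCoef_quadratic, inv_mul_le_iff₀ h', ← mul_assoc, Real.mul_self_sqrt (gramDet_pos v).le,
    gramDet]
  -- By Lagrange's identity the gap is exactly this square.
  nlinarith [sq_nonneg (x * v 0 + y * v 1)]

lemma abs_slopeCoef_le (v : EuclideanSpace ℝ (Fin 2)) (i j : Fin 2) :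
    |slopeCoef v i j| ≤ √(gramDet v) := by
  have h' := Real.sqrt_pos.2 (gramDet_pos v)
  rw [slopeCoef, Matrix.smul_apply, smul_eq_mul, abs_mul, abs_of_pos (inv_pos.2 h'),
    inv_mul_le_iff₀ h', Real.mul_self_sqrt (gramDet_pos v).le, abs_le, gramDet]
  fin_cases i <;> fin_cases j <;> simp <;> constructor <;>
    nlinarith [sq_nonneg (v 0), sq_nonneg (v 1), sq_nonneg (v 0 - v 1), sq_nonneg (v 0 + v 1)]

lemma contDiff_slopeCoef (i j : Fin 2) : ContDiff ℝ 1 fun v => slopeCoef v i j := by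
  have h1 : ContDiff ℝ 1 gramDet := by unfold gramDet; fun_prop
  have h2 : ContDiff ℝ 1 fun v => (√(gramDet v))⁻¹ :=
    (h1.sqrt fun v => (gramDet_pos v).ne').inv fun v => (Real.sqrt_pos.2 (gramDet_pos v)).ne'
  simp only [slopeCoef, Matrix.smul_apply, smul_eq_mul]
  refine h2.mul ?_
  fin_cases i <;> fin_cases j <;> simp <;> fun_prop

lemma exists_lipschitz_slopeCoef (K : ℝ) (i j : Fin 2) : ∃ C : NNReal,
    LipschitzOnWith C (fun v => slopeCoef v i j) (Metric.closedBall 0 K) :=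
  LocallyLipschitzOn.exists_lipschitzOnWith_of_compact (isCompact_closedBall 0 K)
    (contDiff_slopeCoef i j).locallyLipschitz.locallyLipschitzOn

/-! ### The random coefficient and its derivatives along translations. -/

namespace SurfaceSpace

section Slope

variable {d : ℕ}

lemma gradient_translate (x y : EuclideanSpace ℝ (Fin d)) (h : SurfaceSpace d) :
    gradient (translate x h) y = gradient h (y + x) := by
  rw [gradient, gradient]
  congr 1
  exact fderiv_comp_add_right x

lemma norm_gradient (h : SurfaceSpace d) (x : EuclideanSpace ℝ (Fin d)) :
    ‖gradient h x‖ = ‖fderiv ℝ h x‖ := by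
  rw [gradient, LinearIsometryEquiv.norm_map]

lemma contDiff_gradient (h : SurfaceSpace d) : ContDiff ℝ 2 fun y => gradient h y :=
  (InnerProductSpace.toDual ℝ (EuclideanSpace ℝ (Fin d))).symm.contDiff.comp
    (h.contDiff'.fderiv_right (by norm_num))

lemma lipschitz_gradient {h : SurfaceSpace d} {K : ℝ} (hK : 0 ≤ K)
    (hb : ∀ x, ‖iteratedFDeriv ℝ 2 h x‖ ≤ K) : LipschitzWith K.toNNReal fun y => gradient h y := by
  have hd : Differentiable ℝ (fderiv ℝ h) :=
    (h.contDiff'.fderiv_right (m := 2) (by norm_num)).differentiable (by norm_num)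
  have h1 : LipschitzWith K.toNNReal (fderiv ℝ h) := by
    refine lipschitzWith_of_nnnorm_fderiv_le hd fun x => ?_
    rw [← NNReal.coe_le_coe, coe_nnnorm, Real.coe_toNNReal _ hK, ← norm_iteratedFDeriv_one]
    rw [norm_iteratedFDeriv_fderiv]
    exact hb x
  simpa only [one_mul] using!
    (InnerProductSpace.toDual ℝ (EuclideanSpace ℝ (Fin d))).symm.lipschitz.comp h1

lemma continuous_fderiv_eval (x : EuclideanSpace ℝ (Fin d)) :
    Continuous fun h : SurfaceSpace d => fderiv ℝ h x := by
  have h1 : Continuous fun h : SurfaceSpace d => jet 1 h x :=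
    (continuous_eval_const x).comp
      ((continuous_apply (1 : Fin 4)).comp isInducing_jet.continuous)
  have h2 : (fun h : SurfaceSpace d => fderiv ℝ h x) = fun h : SurfaceSpace d =>
      (continuousMultilinearCurryFin1 ℝ (EuclideanSpace ℝ (Fin d)) ℝ) (jet 1 h x) := by
    funext h
    ext v
    rw [continuousMultilinearCurryFin1_apply]
    change _ = iteratedFDeriv ℝ 1 h x (Fin.snoc 0 v)
    rw [iteratedFDeriv_one_apply]
    rfl
  rw [h2]
  exact (LinearIsometryEquiv.continuous _).comp h1

lemma continuous_gradient_eval (x : EuclideanSpace ℝ (Fin d)) :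
    Continuous fun h : SurfaceSpace d => gradient h x :=
  (LinearIsometryEquiv.continuous _).comp (continuous_fderiv_eval x)

end Slope

/-- The coefficient `√|g| g⁻¹ (x, h)`. -/
def coef (x : EuclideanSpace ℝ (Fin 2)) (h : SurfaceSpace 2) : Matrix (Fin 2) (Fin 2) ℝ :=
  slopeCoef (gradient h x)

lemma area_eq (x : EuclideanSpace ℝ (Fin 2)) (h : SurfaceSpace 2) :
    area x h = √(gramDet (gradient h x)) := by
  rw [area, metric, det_metric_of_slope]

lemma area_mul_inv_metric (x : EuclideanSpace ℝ (Fin 2)) (h : SurfaceSpace 2) (i j : Fin 2) :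
    area x h * (metric x h)⁻¹ i j = coef x h i j := by
  rw [area_eq]; exact sqrt_mul_inv_of_slope _ i j

lemma one_le_area (x : EuclideanSpace ℝ (Fin 2)) (h : SurfaceSpace 2) : 1 ≤ area x h := by
  rw [area_eq, Real.one_le_sqrt]; exact one_le_gramDet _

lemma area_le {x : EuclideanSpace ℝ (Fin 2)} {h : SurfaceSpace 2} {K : ℝ}
    (hK : ‖gradient h x‖ ≤ K) : area x h ≤ √(1 + K ^ 2) := by
  rw [area_eq, gramDet_eq]
  gcongr

lemma coef_translate (x y : EuclideanSpace ℝ (Fin 2)) (h : SurfaceSpace 2) :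
    coef y (translate x h) = coef (y + x) h := by
  rw [coef, coef, gradient_translate]

lemma measurable_coef (x : EuclideanSpace ℝ (Fin 2)) (i j : Fin 2) :
    Measurable fun h => coef x h i j :=
  ((contDiff_slopeCoef i j).continuous.comp (continuous_gradient_eval x)).measurable

lemma measurable_area (x : EuclideanSpace ℝ (Fin 2)) :
    Measurable fun h : SurfaceSpace 2 => area x h := by
  have : Continuous gramDet := by unfold gramDet; fun_prop
  simp only [area_eq]
  exact (this.comp (continuous_gradient_eval x)).sqrt.measurable

lemma differentiable_coef (h : SurfaceSpace 2) (i j : Fin 2) :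
    Differentiable ℝ fun y => coef y h i j :=
  ((contDiff_slopeCoef i j).differentiable (by norm_num)).comp
    ((contDiff_gradient h).differentiable (by norm_num))

/-- The derivative of the coefficient in direction `e_k` at the origin. -/
def coefDeriv (k : Fin 2) (i j : Fin 2) (h : SurfaceSpace 2) : ℝ :=
  fderiv ℝ (fun y => coef y h i j) 0 (EuclideanSpace.single k 1)

lemma tendsto_coef_slope (k i j : Fin 2) (h : SurfaceSpace 2) :
    Tendsto (fun s : ℝ => (coef (EuclideanSpace.single k s) h i j - coef 0 h i j) / s) (𝓝[≠] 0)
      (𝓝 (coefDeriv k i j h)) := by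
  have h1 : HasDerivAt (fun s : ℝ => coef (s • EuclideanSpace.single k (1 : ℝ)) h i j)
      (coefDeriv k i j h) 0 := by
    have h2 : HasDerivAt (fun s : ℝ => s • EuclideanSpace.single k (1 : ℝ))
        (EuclideanSpace.single k (1 : ℝ)) 0 := by
      simpa using (hasDerivAt_id (0 : ℝ)).smul_const (EuclideanSpace.single k (1 : ℝ))
    have h3 : HasFDerivAt (fun y => coef y h i j) (fderiv ℝ (fun y => coef y h i j) 0)
        ((0 : ℝ) • EuclideanSpace.single k (1 : ℝ)) := by
      rw [zero_smul]; exact (differentiable_coef h i j 0).hasFDerivAt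
    exact h3.comp_hasDerivAt (0 : ℝ) h2
  refine h1.tendsto_slope_zero.congr fun s => ?_
  have e0 : s • EuclideanSpace.single k (1 : ℝ) = EuclideanSpace.single k s := by
    ext j
    simp
  rw [zero_add, zero_smul, e0, smul_eq_mul, div_eq_inv_mul]

/-- A pointwise limit of measurable difference quotients, along the steps `1 / (n + 1)`. -/
lemma measurable_coefDeriv (k i j : Fin 2) : Measurable (coefDeriv k i j) := by
  have hlim : Tendsto (fun n : ℕ => (1 : ℝ) / ((n : ℝ) + 1)) atTop (𝓝[≠] 0) :=
    tendsto_nhdsWithin_iff.2 ⟨tendsto_one_div_add_atTop_nhds_zero_nat,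
      Eventually.of_forall fun n => by
        have : (0 : ℝ) < 1 / ((n : ℝ) + 1) := by positivity
        exact this.ne'⟩
  refine measurable_of_tendsto_metrizable (f := fun (n : ℕ) (h : SurfaceSpace 2) =>
    (coef (EuclideanSpace.single k ((1 : ℝ) / ((n : ℝ) + 1))) h i j - coef 0 h i j) /
      ((1 : ℝ) / ((n : ℝ) + 1))) (fun n => ?_) (tendsto_pi_nhds.2 fun h => ?_)
  · exact ((measurable_coef _ i j).sub (measurable_coef _ i j)).div_const _
  · exact (tendsto_coef_slope k i j h).comp hlim

variable {P : Measure (SurfaceSpace 2)}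

/-- The slope and the curvature are bounded by `K` almost surely. -/
def BoundedBy (P : Measure (SurfaceSpace 2)) (K : ℝ) : Prop :=
  0 < K ∧ ∀ᵐ h : SurfaceSpace 2 ∂P, ∀ x : EuclideanSpace ℝ (Fin 2),
    ‖gradient h x‖ ≤ K ∧ ‖iteratedFDeriv ℝ 2 h x‖ ≤ K

lemma HasBoundedDerivs.exists_boundedBy (hD : HasBoundedDerivs P) : ∃ K, BoundedBy P K := by
  obtain ⟨K, hK, h⟩ := hD
  refine ⟨K, hK, h.mono fun f hf x => ?_⟩
  have := hf x
  rw [norm_gradient]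
  constructor <;> linarith [norm_nonneg (fderiv ℝ f x), norm_nonneg (iteratedFDeriv ℝ 2 f x)]

namespace BoundedBy

variable {K : ℝ}

lemma area_le (hK : BoundedBy P K) : ∀ᵐ h ∂P, ‖area 0 h‖ ≤ √(1 + K ^ 2) := by
  filter_upwards [hK.2] with h hh
  rw [Real.norm_of_nonneg (zero_le_one.trans (one_le_area 0 h))]
  exact SurfaceSpace.area_le (hh 0).1

lemma coef_le (hK : BoundedBy P K) (i j : Fin 2) : ∀ᵐ h ∂P, ‖coef 0 h i j‖ ≤ √(1 + K ^ 2) := by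
  filter_upwards [hK.2] with h hh
  refine (abs_slopeCoef_le _ i j).trans ?_
  rw [gramDet_eq]
  gcongr
  exact (hh 0).1

/-- The slope bound keeps the gradient in a ball where `slopeCoef` is Lipschitz, and the curvature
bound makes the gradient Lipschitz in `x`. The deterministic constant is what dominates the
difference quotients in `hasL2Deriv_coef`. -/
lemma coef_slope_le (hK : BoundedBy P K) (i j : Fin 2) : ∃ C : ℝ, ∀ᵐ h ∂P, ∀ (k : Fin 2) (s : ℝ),
    |(coef (EuclideanSpace.single k s) h i j - coef 0 h i j) / s| ≤ C := by
  obtain ⟨C, hC⟩ := exists_lipschitz_slopeCoef K i j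
  refine ⟨C * K, ?_⟩
  filter_upwards [hK.2] with h hh k s
  rcases eq_or_ne s 0 with rfl | hs
  · simp only [div_zero, abs_zero]
    exact mul_nonneg C.2 hK.1.le
  have h1 := hC.dist_le_mul (gradient h (EuclideanSpace.single k s)) (by simpa using (hh _).1)
    (gradient h 0) (by simpa using (hh _).1)
  have h2 := (lipschitz_gradient hK.1.le fun x => (hh x).2).dist_le_mul
    (EuclideanSpace.single k s) 0
  rw [dist_zero_right, PiLp.norm_single, Real.norm_eq_abs, Real.coe_toNNReal _ hK.1.le] at h2
  rw [abs_div, div_le_iff₀ (abs_pos.2 hs), mul_assoc]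
  exact h1.trans (mul_le_mul_of_nonneg_left h2 C.2)

lemma coefDeriv_le (hK : BoundedBy P K) (k i j : Fin 2) :
    ∃ C : ℝ, ∀ᵐ h ∂P, ‖coefDeriv k i j h‖ ≤ C := by
  obtain ⟨C, hC⟩ := hK.coef_slope_le i j
  refine ⟨C, ?_⟩
  filter_upwards [hC] with h hh
  exact le_of_tendsto (tendsto_coef_slope k i j h).norm (Eventually.of_forall fun s => hh k s)

variable [IsProbabilityMeasure P]

/-- The entries of the coefficient are differentiable along the translations. -/
lemma hasL2Deriv_coef (hK : BoundedBy P K) (k i j : Fin 2) :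
    HasL2Deriv P k (fun h => coef 0 h i j) (coefDeriv k i j) := by
  obtain ⟨C', hC'⟩ := hK.coefDeriv_le k i j
  obtain ⟨C, hC⟩ := hK.coef_slope_le i j
  refine ⟨MemLp.of_bound (measurable_coef 0 i j).aestronglyMeasurable _ (hK.coef_le i j),
    MemLp.of_bound (measurable_coefDeriv k i j).aestronglyMeasurable _ hC', ?_⟩
  simp only [coef_translate, zero_add]
  refine tendsto_eLpNorm_of_dominated (C := C + C') (Eventually.of_forall fun s => ?_)
    (Eventually.of_forall fun s => ?_) (Eventually.of_forall fun h => ?_)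
  · exact ((((measurable_coef _ i j).sub (measurable_coef _ i j)).div_const _).sub
      (measurable_coefDeriv k i j)).aestronglyMeasurable
  · filter_upwards [hC, hC'] with h h1 h2
    exact (norm_sub_le _ _).trans (add_le_add (h1 k s) h2)
  · simpa using (tendsto_coef_slope k i j h).sub_const (coefDeriv k i j h)

end BoundedBy

/-- Against the weight `√|g|` the drift is the divergence of the columns of the coefficient, which
allows integration by parts. -/
lemma area_mul_drift (h : SurfaceSpace 2) (j : Fin 2) :
    area 0 h * drift 0 h j = coefDeriv 0 0 j h + coefDeriv 1 1 j h := by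
  have h1 : area 0 h ≠ 0 := (zero_lt_one.trans_le (one_le_area 0 h)).ne'
  simp only [drift, area_mul_inv_metric, Fin.sum_univ_two]
  rw [← mul_assoc, mul_one_div_cancel h1, one_mul]
  rfl

end SurfaceSpace

namespace DualSystem

variable {E H : Type*} [NormedAddCommGroup E] [NormedSpace ℝ E]
  [NormedAddCommGroup H] [InnerProductSpace ℝ H] {S : DualSystem E H}

/-- The difference of two solutions is itself a potential field, so it is orthogonal to its own flux
and coercivity forces it to vanish. -/
lemma IsCorrector.unique {e : Fin 2 → ℝ} {V W : VecField H} (hV : S.IsCorrector e V)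
    (hW : S.IsCorrector e W) : V = W := by
  have hmem := sub_mem hV.1 hW.1
  have h1 := hV.inner_eq_zero hmem
  have h2 := hW.inner_eq_zero hmem
  rw [map_add, inner_add_left] at h1 h2
  have h3 := S.coercive (V - W)
  rw [map_sub, inner_sub_left] at h3
  have h4 : S.coer * ‖V - W‖ ^ 2 ≤ 0 := by linarith
  have h5 : ‖V - W‖ ^ 2 ≤ 0 := nonpos_of_mul_nonpos_right h4 S.coer_pos
  exact sub_eq_zero.1 (norm_eq_zero.1 (pow_eq_zero_iff (two_ne_zero) |>.1
    (le_antisymm h5 (sq_nonneg _))))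

end DualSystem

/-! ### The random surface as a dual system. -/

namespace SurfaceSpace

variable {P : Measure (SurfaceSpace 2)} {K : ℝ}

/-- A field invariant in both coordinate directions is invariant. -/
lemma koopman_eq_self [IsProbabilityMeasure P] (hA : IsStationary P) {f : Lp ℝ 2 P}
    (hf : ∀ (i : Fin 2) (s : ℝ), koopman hA (s • EuclideanSpace.single i 1) f = f)
    (x : EuclideanSpace ℝ (Fin 2)) : koopman hA x f = f := by
  have hx : x = x 0 • EuclideanSpace.single 0 1 + x 1 • EuclideanSpace.single 1 1 := by
    ext i; fin_cases i <;> simp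
  rw [hx]
  exact ((koopmanRep hA).add_apply _ _ f).trans ((congrArg _ (hf 1 _)).trans (hf 0 _))

namespace BoundedBy

/-- Multiplication by an entry of the coefficient. -/
def coefOp (hK : BoundedBy P K) (i j : Fin 2) : Lp ℝ 2 P →L[ℝ] Lp ℝ 2 P :=
  mulL2 (fun h => coef 0 h i j) (measurable_coef 0 i j).aestronglyMeasurable _ (hK.coef_le i j)

/-- Multiplication by the surface element. -/
def areaOp (hK : BoundedBy P K) : Lp ℝ 2 P →L[ℝ] Lp ℝ 2 P :=
  mulL2 (fun h => area 0 h) (measurable_area 0).aestronglyMeasurable _ hK.area_le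

lemma coeFn_coefOp (hK : BoundedBy P K) (i j : Fin 2) (f : Lp ℝ 2 P) :
    hK.coefOp i j f =ᵐ[P] fun h => coef 0 h i j * f h :=
  coeFn_mulL2 _ _ f

lemma coeFn_areaOp (hK : BoundedBy P K) (f : Lp ℝ 2 P) :
    hK.areaOp f =ᵐ[P] fun h => area 0 h * f h :=
  coeFn_mulL2 _ _ f

/-- Definitional: the two off-diagonal entries of `slopeCoef` are the same expression. -/
lemma coefOp_one_zero (hK : BoundedBy P K) : hK.coefOp 1 0 = hK.coefOp 0 1 := rfl

lemma coefOp_comm (hK : BoundedBy P K) (i j k l : Fin 2) (f : Lp ℝ 2 P) :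
    hK.coefOp i j (hK.coefOp k l f) = hK.coefOp k l (hK.coefOp i j f) := by
  refine Lp.ext ?_
  filter_upwards [hK.coeFn_coefOp i j (hK.coefOp k l f), hK.coeFn_coefOp k l f,
    hK.coeFn_coefOp k l (hK.coefOp i j f), hK.coeFn_coefOp i j f] with h h1 h2 h3 h4
  rw [h1, h2, h3, h4]
  ring

lemma coefOp_det (hK : BoundedBy P K) (f : Lp ℝ 2 P) :
    hK.coefOp 0 0 (hK.coefOp 1 1 f) - hK.coefOp 0 1 (hK.coefOp 0 1 f) = f := by
  refine Lp.ext ?_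
  filter_upwards [hK.coeFn_coefOp 0 0 (hK.coefOp 1 1 f), hK.coeFn_coefOp 1 1 f,
    hK.coeFn_coefOp 0 1 (hK.coefOp 0 1 f), hK.coeFn_coefOp 0 1 f,
    Lp.coeFn_sub (hK.coefOp 0 0 (hK.coefOp 1 1 f)) (hK.coefOp 0 1 (hK.coefOp 0 1 f))]
    with h h1 h2 h3 h4 h5
  rw [h5, Pi.sub_apply, h1, h2, h3, h4]
  have hdet : coef 0 h 0 0 * coef 0 h 1 1 - coef 0 h 0 1 * coef 0 h 0 1 = 1 := slopeCoef_det _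
  linear_combination f h * hdet

/-- The bilinear form of the coefficient is integrable. -/
lemma integrable_and_inner_eq (hK : BoundedBy P K) {U W : VecField (Lp ℝ 2 P)}
    {u w : Fin 2 → SurfaceSpace 2 → ℝ} (hu : ∀ i, U i =ᵐ[P] u i) (hw : ∀ i, W i =ᵐ[P] w i) :
    Integrable (fun h => u 0 h * (coef 0 h 0 0 * w 0 h + coef 0 h 0 1 * w 1 h) +
      u 1 h * (coef 0 h 0 1 * w 0 h + coef 0 h 1 1 * w 1 h)) P ∧
    inner ℝ U (matOp hK.coefOp W) =
      ∫ h, (u 0 h * (coef 0 h 0 0 * w 0 h + coef 0 h 0 1 * w 1 h) +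
        u 1 h * (coef 0 h 0 1 * w 0 h + coef 0 h 1 1 * w 1 h)) ∂P := by
  have hcomp : ∀ i, (fun h => inner ℝ ((U i : Lp ℝ 2 P) h) ((matOp hK.coefOp W i : Lp ℝ 2 P) h))
      =ᵐ[P] fun h => u i h * (coef 0 h i 0 * w 0 h + coef 0 h i 1 * w 1 h) := fun i => by
    rw [matOp_apply]
    filter_upwards [hu i, hw 0, hw 1, hK.coeFn_coefOp i 0 (W 0), hK.coeFn_coefOp i 1 (W 1),
      Lp.coeFn_add (hK.coefOp i 0 (W 0)) (hK.coefOp i 1 (W 1))] with h h1 h2 h3 h4 h5 h6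
    rw [h6, Pi.add_apply, h5, h4, h3, h2, h1]
    simp [mul_comm]
  have hint : ∀ i, Integrable (fun h => u i h * (coef 0 h i 0 * w 0 h + coef 0 h i 1 * w 1 h)) P :=
    fun i => (L2.integrable_inner (𝕜 := ℝ) (U i) (matOp hK.coefOp W i)).congr (hcomp i)
  refine ⟨(hint 0).add (hint 1), ?_⟩
  rw [VecField.inner_eq, L2.inner_def, L2.inner_def, integral_congr_ae (hcomp 0),
    integral_congr_ae (hcomp 1), ← integral_add (hint 0) (hint 1)]
  rfl

lemma inner_symm (hK : BoundedBy P K) (U W : VecField (Lp ℝ 2 P)) :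
    inner ℝ (matOp hK.coefOp U) W = inner ℝ U (matOp hK.coefOp W) := by
  rw [real_inner_comm, (hK.integrable_and_inner_eq (fun i => ae_eq_refl (W i))
    (fun i => ae_eq_refl (U i))).2, (hK.integrable_and_inner_eq (fun i => ae_eq_refl (U i))
    (fun i => ae_eq_refl (W i))).2]
  congr 1
  funext h
  ring

lemma inner_self_eq (U : VecField (Lp ℝ 2 P)) :
    Integrable (fun h => (U 0 : Lp ℝ 2 P) h ^ 2 + (U 1 : Lp ℝ 2 P) h ^ 2) P ∧
    ‖U‖ ^ 2 = ∫ h, ((U 0 : Lp ℝ 2 P) h ^ 2 + (U 1 : Lp ℝ 2 P) h ^ 2) ∂P := by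
  have h : ∀ i, Integrable (fun h => (U i : Lp ℝ 2 P) h ^ 2) P := fun i => by
    simpa [sq] using L2.integrable_inner (𝕜 := ℝ) (U i) (U i)
  refine ⟨(h 0).add (h 1), ?_⟩
  rw [integral_add (h 0) (h 1), ← real_inner_self_eq_norm_sq, VecField.inner_eq, L2.inner_def,
    L2.inner_def]
  simp [sq]

/-- The smallest eigenvalue of `√|g| g⁻¹` is `1 / √|g|`, and `√(1 + K ^ 2)` bounds `√|g|`. -/
lemma coercive (hK : BoundedBy P K) (U : VecField (Lp ℝ 2 P)) :
    (√(1 + K ^ 2))⁻¹ * ‖U‖ ^ 2 ≤ inner ℝ (matOp hK.coefOp U) U := by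
  obtain ⟨h1, h2⟩ := hK.integrable_and_inner_eq (fun i => ae_eq_refl (U i))
    (fun i => ae_eq_refl (U i))
  rw [real_inner_comm, h2, (inner_self_eq U).2, ← integral_const_mul]
  refine integral_mono_ae ((inner_self_eq U).1.const_mul _) h1 ?_
  filter_upwards [hK.2] with h hh
  refine le_trans ?_ (le_slopeCoef_quadratic (gradient h 0) _ _)
  refine mul_le_mul_of_nonneg_right ?_ (by positivity)
  have h' := Real.sqrt_pos.2 (gramDet_pos (gradient h 0))
  rw [gramDet_eq] at *
  gcongr
  exact (hh 0).1

/-- For a symmetric `2 × 2` matrix, `A J A = det A • J`. The entries are commuting multiplication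
operators, so the scalar computation carries over. -/
lemma duality (hK : BoundedBy P K) (U : VecField (Lp ℝ 2 P)) :
    matOp hK.coefOp (rot (matOp hK.coefOp U)) = rot U := by
  have hd := hK.coefOp_det
  ext1 i
  fin_cases i
  · have h1 := hd (U 1)
    have h2 := hK.coefOp_comm 0 0 0 1 (U 0)
    simp only [Fin.zero_eta, Fin.isValue, matOp_apply, rot_apply_zero, rot_apply_one,
      coefOp_one_zero, map_neg, map_add]
    linear_combination (norm := module) (-1 : ℝ) • h1 - h2
  · have h1 := hd (U 0)
    have h2 := hK.coefOp_comm 1 1 0 0 (U 0)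
    have h3 := hK.coefOp_comm 0 1 1 1 (U 1)
    simp only [Fin.mk_one, Fin.isValue, matOp_apply, rot_apply_zero, rot_apply_one,
      coefOp_one_zero, map_neg, map_add]
    linear_combination (norm := module) h1 + h2 - h3

lemma weight (hK : BoundedBy P K) (u : Lp ℝ 2 P) : ‖u‖ ^ 2 ≤ inner ℝ (hK.areaOp u) u := by
  rw [← real_inner_self_eq_norm_sq, L2.inner_def, L2.inner_def]
  refine integral_mono_ae (L2.integrable_inner u u) (L2.integrable_inner _ _) ?_
  filter_upwards [hK.coeFn_areaOp u] with h hh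
  simp only [hh, RCLike.inner_apply, conj_trivial]
  nlinarith [one_le_area 0 h, mul_self_nonneg (u h)]

variable [IsProbabilityMeasure P]

/-- The homogenization problem of the random surface. -/
def dualSystem (hK : BoundedBy P K) (hA : IsStationary P) (hB : IsErgodicField P) :
    DualSystem (EuclideanSpace ℝ (Fin 2)) (Lp ℝ 2 P) where
  T := koopmanRep hA
  dir i := EuclideanSpace.single i 1
  one := oneL2 P
  norm_one := norm_oneL2
  apply_one := koopman_oneL2 hA
  ergodic f hf := hB.exists_eq_smul_oneL2 hA f (koopman_eq_self hA hf)
  A := matOp hK.coefOp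
  symm := hK.inner_symm
  coer := (√(1 + K ^ 2))⁻¹
  coer_pos := by positivity
  coercive := hK.coercive
  duality := hK.duality
  W := hK.areaOp
  weight := hK.weight

end BoundedBy

end SurfaceSpace

/-! ### From functions on `Ω` to the abstract problem and back. -/

namespace SurfaceSpace

variable {P : Measure (SurfaceSpace 2)} {K : ℝ}

/-- The class of a square-integrable vector field. -/
def toField (V : SurfaceSpace 2 → Fin 2 → ℝ) (hV : ∀ i, MemLp (fun h => V h i) 2 P) :
    VecField (Lp ℝ 2 P) :=
  WithLp.toLp 2 fun i => (hV i).toLp _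

lemma coeFn_toField {V : SurfaceSpace 2 → Fin 2 → ℝ} (hV : ∀ i, MemLp (fun h => V h i) 2 P)
    (i : Fin 2) : toField V hV i =ᵐ[P] fun h => V h i :=
  (hV i).coeFn_toLp

lemma bilinear_mul_area (h : SurfaceSpace 2) (x y : Fin 2 → ℝ) :
    (x ⬝ᵥ ((metric 0 h)⁻¹ *ᵥ y)) * area 0 h =
      x 0 * (coef 0 h 0 0 * y 0 + coef 0 h 0 1 * y 1) +
        x 1 * (coef 0 h 0 1 * y 0 + coef 0 h 1 1 * y 1) := by
  have h10 : coef 0 h 0 1 = coef 0 h 1 0 := rfl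
  nth_rw 2 [h10]
  simp only [← area_mul_inv_metric, dotProduct, Matrix.mulVec, Fin.sum_univ_two]
  ring

lemma drift_mul_area (h : SurfaceSpace 2) (e : Fin 2 → ℝ) :
    (drift 0 h ⬝ᵥ e) * area 0 h = e 0 * (coefDeriv 0 0 0 h + coefDeriv 1 0 1 h) +
      e 1 * (coefDeriv 0 0 1 h + coefDeriv 1 1 1 h) := by
  have h10 : coefDeriv 1 0 1 h = coefDeriv 1 1 0 h := rfl
  rw [h10, ← area_mul_drift, ← area_mul_drift]
  simp only [dotProduct, Fin.sum_univ_two]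
  ring

lemma HasL2Deriv.integral_mul [IsProbabilityMeasure P] (hA : IsStationary P) {i : Fin 2}
    {f f' g g' : SurfaceSpace 2 → ℝ} (hf : HasL2Deriv P i f f') (hg : HasL2Deriv P i g g') :
    ∫ h, f' h * g h ∂P = -∫ h, f h * g' h ∂P := by
  obtain ⟨hf0, hf1, hf2⟩ := (hasL2Deriv_iff hA).1 hf
  obtain ⟨hg0, hg1, hg2⟩ := (hasL2Deriv_iff hA).1 hg
  have key := hf2.inner_eq hg2
  rw [L2.inner_def, L2.inner_def] at key
  have e1 : ∫ h, f' h * g h ∂P = ∫ h, inner ℝ (hf1.toLp f' h) (hg0.toLp g h) ∂P := by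
    refine integral_congr_ae ?_
    filter_upwards [hf1.coeFn_toLp, hg0.coeFn_toLp] with h h1 h2
    rw [h1, h2]
    simp [mul_comm]
  have e2 : ∫ h, f h * g' h ∂P = ∫ h, inner ℝ (hf0.toLp f h) (hg1.toLp g' h) ∂P := by
    refine integral_congr_ae ?_
    filter_upwards [hf0.coeFn_toLp, hg1.coeFn_toLp] with h h1 h2
    rw [h1, h2]
    simp [mul_comm]
  rw [e1, e2, key]

lemma integral_combination {Ω : Type*} [MeasurableSpace Ω] {P : Measure Ω} {f g p q : Ω → ℝ}
    {a b : ℝ} (hf : Integrable f P) (hg : Integrable g P) (hp : Integrable p P)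
    (hq : Integrable q P) : ∫ ω, (a * (f ω + g ω) + b * (p ω + q ω)) ∂P =
      a * (∫ ω, f ω ∂P + ∫ ω, g ω ∂P) + b * (∫ ω, p ω ∂P + ∫ ω, q ω ∂P) := by
  have h1 : Integrable (fun ω => a * (f ω + g ω)) P := (hf.add hg).const_mul a
  have h2 : Integrable (fun ω => b * (p ω + q ω)) P := (hp.add hq).const_mul b
  rw [integral_add h1 h2, integral_const_mul,
    integral_const_mul, integral_add hf hg, integral_add hp hq]

namespace BoundedBy

lemma memLp_drift [IsProbabilityMeasure P] (hK : BoundedBy P K) (e : Fin 2 → ℝ) :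
    MemLp (fun h => drift 0 h ⬝ᵥ e) 2 P := by
  have hd : ∀ k i j, MemLp (coefDeriv k i j) 2 P := fun k i j => (hK.hasL2Deriv_coef k i j).2.1
  have h1 : MemLp (fun h => (drift 0 h ⬝ᵥ e) * area 0 h) 2 P := by
    simp only [drift_mul_area]
    exact (((hd 0 0 0).add (hd 1 0 1)).const_mul (e 0)).add
      (((hd 0 0 1).add (hd 1 1 1)).const_mul (e 1))
  have h2 : ∀ h : SurfaceSpace 2, (drift 0 h ⬝ᵥ e) =
      (area 0 h)⁻¹ * ((drift 0 h ⬝ᵥ e) * area 0 h) := fun h => by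
    have : area 0 h ≠ 0 := (zero_lt_one.trans_le (one_le_area 0 h)).ne'
    field_simp
  have h3 : (fun h => drift 0 h ⬝ᵥ e) = fun h : SurfaceSpace 2 =>
      (area 0 h)⁻¹ * ((drift 0 h ⬝ᵥ e) * area 0 h) := funext h2
  rw [h3]
  refine memLp_bdd_mul (measurable_area 0).inv.aestronglyMeasurable (C := 1)
    (Eventually.of_forall fun h => ?_) h1
  rw [norm_inv, Real.norm_of_nonneg (zero_le_one.trans (one_le_area 0 h))]
  exact inv_le_one_of_one_le₀ (one_le_area 0 h)

lemma integrable_area [IsProbabilityMeasure P] (hK : BoundedBy P K) :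
    Integrable (fun h => area 0 h) P :=
  Integrable.of_bound (measurable_area 0).aestronglyMeasurable _ hK.area_le

lemma one_le_meanArea [IsProbabilityMeasure P] (hK : BoundedBy P K) : 1 ≤ meanArea P := by
  have := integral_mono (integrable_const (μ := P) (1 : ℝ)) hK.integrable_area
    (fun h => one_le_area 0 h)
  simpa [meanArea] using this

lemma energy_eq (hK : BoundedBy P K) {U W : SurfaceSpace 2 → Fin 2 → ℝ}
    {U' W' : VecField (Lp ℝ 2 P)} (hU : ∀ i, U' i =ᵐ[P] fun h => U h i)
    (hW : ∀ i, W' i =ᵐ[P] fun h => W h i) :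
    energy P U W = 1 / meanArea P * inner ℝ U' (matOp hK.coefOp W') := by
  rw [energy, (hK.integrable_and_inner_eq hU hW).2]
  simp only [bilinear_mul_area]

variable [IsProbabilityMeasure P]

/-- Integration by parts puts the drift in divergence form, giving the right-hand side of the
abstract resolvent equation. -/
lemma integral_drift_mul (hK : BoundedBy P K) (hA : IsStationary P) (e : Fin 2 → ℝ)
    {φ : SurfaceSpace 2 → ℝ} {Φ : SurfaceSpace 2 → Fin 2 → ℝ} (hφ : HasL2Gradient P φ Φ)
    {Φ' : VecField (Lp ℝ 2 P)} (hΦ : ∀ i, Φ' i =ᵐ[P] fun h => Φ h i) :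
    ∫ h, (drift 0 h ⬝ᵥ e) * φ h * area 0 h ∂P =
      -inner ℝ (matOp hK.coefOp (const (oneL2 P) e)) Φ' := by
  have hc : ∀ i, (const (oneL2 P) e : VecField (Lp ℝ 2 P)) i =ᵐ[P] fun _ => e i := fun i => by
    rw [const_apply]
    filter_upwards [Lp.coeFn_smul (e i) (oneL2 P), coeFn_oneL2 (P := P)] with h h1 h2
    rw [h1, Pi.smul_apply, h2, smul_eq_mul, mul_one]
  have hI : ∀ k i j, ∫ h, coefDeriv k i j h * φ h ∂P = -∫ h, coef 0 h i j * Φ h k ∂P :=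
    fun k i j => (hK.hasL2Deriv_coef k i j).integral_mul hA (hφ k)
  have hi1 : ∀ k i j, Integrable (fun h => coefDeriv k i j h * φ h) P := fun k i j =>
    (hK.hasL2Deriv_coef k i j).2.1.integrable_mul (hφ k).1
  have hi2 : ∀ k i j, Integrable (fun h => coef 0 h i j * Φ h k) P := fun k i j =>
    (hK.hasL2Deriv_coef k i j).1.integrable_mul (hφ k).2.1
  have e1 : ∀ h : SurfaceSpace 2, (drift 0 h ⬝ᵥ e) * φ h * area 0 h =
      e 0 * (coefDeriv 0 0 0 h * φ h + coefDeriv 1 0 1 h * φ h) +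
        e 1 * (coefDeriv 0 0 1 h * φ h + coefDeriv 1 1 1 h * φ h) := fun h => by
    rw [mul_right_comm, drift_mul_area]; ring
  rw [hK.inner_symm, (hK.integrable_and_inner_eq hc hΦ).2, integral_congr_ae (ae_of_all _ e1),
    integral_combination (hi1 0 0 0) (hi1 1 0 1) (hi1 0 0 1) (hi1 1 1 1),
    integral_combination (hi2 0 0 0) (hi2 1 0 1) (hi2 0 0 1) (hi2 1 1 1), hI, hI, hI, hI]
  ring

/-- Substituting `v = lam u - F · e` eliminates `v`: the weak definition of the generator becomes
the weak resolvent equation, up to the factor `1 / Z`. -/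
lemma innerPi_neg_eq (hK : BoundedBy P K) (hA : IsStationary P) {e : Fin 2 → ℝ} {lam : ℝ}
    {u v φ : SurfaceSpace 2 → ℝ} {Φ : SurfaceSpace 2 → Fin 2 → ℝ} {u' φ' : Lp ℝ 2 P}
    {Φ' : VecField (Lp ℝ 2 P)} (hu : u' =ᵐ[P] u)
    (hv : ∀ᵐ h ∂P, lam * u h - v h = drift 0 h ⬝ᵥ e) (hφ : HasL2Gradient P φ Φ)
    (hφ' : φ' =ᵐ[P] φ) (hΦ : ∀ i, Φ' i =ᵐ[P] fun h => Φ h i) :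
    innerPi P (fun h => -v h) φ = 1 / meanArea P *
      (-inner ℝ (matOp hK.coefOp (const (oneL2 P) e)) Φ' - lam * inner ℝ (hK.areaOp u') φ') := by
  have e1 : (fun h => inner ℝ (hK.areaOp u' h) (φ' h)) =ᵐ[P] fun h => u h * φ h * area 0 h := by
    filter_upwards [hK.coeFn_areaOp u', hu, hφ'] with h h1 h2 h3
    rw [h1, h2, h3]
    simp only [RCLike.inner_apply, conj_trivial]
    ring
  have hi1 : Integrable (fun h => u h * φ h * area 0 h) P :=
    (L2.integrable_inner (𝕜 := ℝ) (hK.areaOp u') φ').congr e1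
  have hi2 : Integrable (fun h => (drift 0 h ⬝ᵥ e) * φ h * area 0 h) P := by
    refine Integrable.mul_bdd ((hK.memLp_drift e).integrable_mul (hφ 0).1)
      (measurable_area 0).aestronglyMeasurable hK.area_le
  rw [innerPi, ← hK.integral_drift_mul hA e hφ hΦ, L2.inner_def, integral_congr_ae e1,
    ← integral_const_mul lam, ← integral_sub hi2 (hi1.const_mul _)]
  congr 1
  refine integral_congr_ae ?_
  filter_upwards [hv] with h hh
  rw [← hh]
  ring

variable (hK : BoundedBy P K) (hA : IsStationary P) (hB : IsErgodicField P)

lemma hasL2Gradient_of_mem {q : WithLp 2 (Lp ℝ 2 P × VecField (Lp ℝ 2 P))}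
    (hq : q ∈ (hK.dualSystem hA hB).T.gradGraph (hK.dualSystem hA hB).dir) :
    HasL2Gradient P q.fst (fun h i => (q.snd i : Lp ℝ 2 P) h) := by
  intro i
  refine (hasL2Deriv_iff hA).2 ⟨Lp.memLp _, Lp.memLp _, ?_⟩
  rw [Lp.toLp_coeFn, Lp.toLp_coeFn]
  exact hq i

lemma mem_gradGraph {φ : SurfaceSpace 2 → ℝ} {Φ : SurfaceSpace 2 → Fin 2 → ℝ}
    (hφ : HasL2Gradient P φ Φ) : WithLp.toLp 2 ((hφ 0).1.toLp φ, toField Φ fun i => (hφ i).2.1) ∈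
      (hK.dualSystem hA hB).T.gradGraph (hK.dualSystem hA hB).dir := by
  intro i
  obtain ⟨_, _, h⟩ := (hasL2Deriv_iff hA).1 (hφ i)
  exact h

/-- Correctors solve the abstract resolvent equation. -/
lemma isResolvent_of_isCorrector {e : Fin 2 → ℝ} {lam : ℝ} {u : SurfaceSpace 2 → ℝ}
    {U : SurfaceSpace 2 → Fin 2 → ℝ} (h : IsCorrector P e lam u U) :
    ∃ p, (hK.dualSystem hA hB).IsResolvent e lam p ∧ ∀ i, p.snd i =ᵐ[P] fun h => U h i := by
  obtain ⟨v, ⟨hu, hv, hgen⟩, heq⟩ := h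
  refine ⟨_, ⟨hK.mem_gradGraph hA hB hu, fun q hq => ?_⟩, coeFn_toField _⟩
  have hq' := hK.hasL2Gradient_of_mem hA hB hq
  have h1 := hgen _ _ hq'
  rw [hK.innerPi_neg_eq hA (hu 0).1.coeFn_toLp heq hq' (ae_eq_refl _) (fun i => ae_eq_refl _),
    hK.energy_eq (coeFn_toField fun i => (hu i).2.1) (fun i => ae_eq_refl (q.snd i))] at h1
  have hZ : 1 / meanArea P ≠ 0 := by
    have := hK.one_le_meanArea
    positivity
  have h2 := mul_left_cancel₀ hZ h1
  rw [← hK.inner_symm] at h2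
  change lam * inner ℝ (hK.areaOp ((hu 0).1.toLp u)) q.fst +
    inner ℝ (matOp hK.coefOp (toField U fun i => (hu i).2.1)) q.snd =
    -inner ℝ (matOp hK.coefOp (const (oneL2 P) e)) q.snd
  linarith

/-- Solutions of the abstract resolvent equation are correctors. -/
lemma isCorrector_of_isResolvent {e : Fin 2 → ℝ} {lam : ℝ}
    {p : WithLp 2 (Lp ℝ 2 P × VecField (Lp ℝ 2 P))}
    (hp : (hK.dualSystem hA hB).IsResolvent e lam p) :
    IsCorrector P e lam p.fst (fun h i => (p.snd i : Lp ℝ 2 P) h) := by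
  have heq : ∀ᵐ h ∂P, lam * p.fst h - (lam * p.fst h - drift 0 h ⬝ᵥ e) = drift 0 h ⬝ᵥ e :=
    Eventually.of_forall fun h => sub_sub_cancel _ _
  refine ⟨fun h => lam * p.fst h - drift 0 h ⬝ᵥ e,
    ⟨hK.hasL2Gradient_of_mem hA hB hp.1, ((Lp.memLp p.fst).const_mul lam).sub (hK.memLp_drift e),
      fun φ Φ hφ => ?_⟩, heq⟩
  have hΦ := coeFn_toField fun i => (hφ i).2.1
  rw [hK.innerPi_neg_eq hA (ae_eq_refl p.fst) heq hφ (hφ 0).1.coeFn_toLp hΦ,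
    hK.energy_eq (fun i => ae_eq_refl (p.snd i)) hΦ, ← hK.inner_symm]
  have h1 := hp.2 _ (hK.mem_gradGraph hA hB hφ)
  change lam * inner ℝ (hK.areaOp p.fst) ((hφ 0).1.toLp φ) +
    inner ℝ (matOp hK.coefOp p.snd) (toField Φ fun i => (hφ i).2.1) =
    -inner ℝ (matOp hK.coefOp (const (oneL2 P) e)) (toField Φ fun i => (hφ i).2.1) at h1
  congr 1
  linarith

/-- The limit of the `lam`-correctors is the abstract corrector. -/
lemma isCorrector_of_isLimitCorrectorGradient {e : Fin 2 → ℝ}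
    {V : SurfaceSpace 2 → Fin 2 → ℝ} (hV : IsLimitCorrectorGradient P e V) :
    (hK.dualSystem hA hB).IsCorrector e (toField V hV.1) := by
  obtain ⟨u, U, hcor, hlim⟩ := hV.2
  obtain ⟨W, hW⟩ := (hK.dualSystem hA hB).exists_isCorrector e
  -- Only positive `lam` matter; the value `0` elsewhere merely makes the choice function total.
  have hex : ∀ lam, ∃ p, 0 < lam → (hK.dualSystem hA hB).IsResolvent e lam p ∧
      ∀ i, p.snd i =ᵐ[P] fun h => U lam h i := fun lam => by
    by_cases hl : 0 < lam
    · obtain ⟨p, hp⟩ := hK.isResolvent_of_isCorrector hA hB (hcor lam hl)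
      exact ⟨p, fun _ => hp⟩
    · exact ⟨0, fun h => absurd h hl⟩
  choose p hp using hex
  have hpW := DualSystem.tendsto_of_isResolvent hW fun l hl => (hp l hl).1
  have hZ := hK.one_le_meanArea
  set α := (√(1 + K ^ 2))⁻¹ with hα
  have hαpos : 0 < α := by positivity
  have hpV : Tendsto (fun l => (p l).snd) (𝓝[>] 0) (𝓝 (toField V hV.1)) := by
    -- Coercivity turns convergence in energy into convergence in `L²`; the factor `meanArea P`
    -- undoes the normalization of the energy. Thus `(p l).snd` tends both to `V` and to the
    -- abstract corrector `W`.
    have hbound : ∀ᶠ l in 𝓝[>] (0 : ℝ), ‖(p l).snd - toField V hV.1‖ ≤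
        √(α⁻¹ * (meanArea P * energy P (fun h => U l h - V h) (fun h => U l h - V h))) := by
      filter_upwards [self_mem_nhdsWithin] with l hl
      have hrep : ∀ i, ((p l).snd - toField V hV.1) i =ᵐ[P] fun h => (U l h - V h) i := fun i => by
        filter_upwards [(hp l hl).2 i, coeFn_toField hV.1 i,
          Lp.coeFn_sub ((p l).snd i) (toField V hV.1 i)] with h h1 h2 h3
        rw [PiLp.sub_apply, h3, Pi.sub_apply, h1, h2, Pi.sub_apply]
      rw [hK.energy_eq hrep hrep, ← hK.inner_symm]
      refine Real.le_sqrt_of_sq_le ?_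
      rw [← mul_assoc (meanArea P), mul_one_div_cancel (by positivity), one_mul,
        le_inv_mul_iff₀ hαpos]
      exact hK.coercive _
    have h0 : Tendsto (fun l => √(α⁻¹ * (meanArea P *
        energy P (fun h => U l h - V h) (fun h => U l h - V h)))) (𝓝[>] 0) (𝓝 0) := by
      simpa using ((hlim.const_mul (meanArea P)).const_mul α⁻¹).sqrt
    rw [tendsto_iff_norm_sub_tendsto_zero]
    exact squeeze_zero' (Eventually.of_forall fun l => norm_nonneg _) hbound h0
  rwa [tendsto_nhds_unique hpV hpW]

lemma exists_isLimitCorrectorGradient (hK : BoundedBy P K) (hA : IsStationary P) (hB : IsErgodicField P)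
    (e : Fin 2 → ℝ) :
    ∃ V, IsLimitCorrectorGradient P e V := by
  obtain ⟨W, hW⟩ := (hK.dualSystem hA hB).exists_isCorrector e
  have hex : ∀ lam, ∃ p, 0 < lam → (hK.dualSystem hA hB).IsResolvent e lam p := fun lam => by
    by_cases hl : 0 < lam
    · obtain ⟨p, hp⟩ := (hK.dualSystem hA hB).exists_isResolvent e hl
      exact ⟨p, fun _ => hp⟩
    · exact ⟨0, fun h => absurd h hl⟩
  choose p hp using hex
  have hpW := DualSystem.tendsto_of_isResolvent hW hp
  refine ⟨fun h i => (W i : Lp ℝ 2 P) h, fun i => Lp.memLp _, fun l => (p l).fst,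
    fun l h i => ((p l).snd i : Lp ℝ 2 P) h,
    fun l hl => hK.isCorrector_of_isResolvent hA hB (hp l hl), ?_⟩
  have hrep : ∀ l i, ((p l).snd - W) i =ᵐ[P] fun h =>
      ((fun i => ((p l).snd i : Lp ℝ 2 P) h) - fun i => (W i : Lp ℝ 2 P) h) i := fun l i => by
    filter_upwards [Lp.coeFn_sub ((p l).snd i) (W i)] with h h3
    rw [PiLp.sub_apply, h3, Pi.sub_apply, Pi.sub_apply]
  simp only [fun l => hK.energy_eq (hrep l) (hrep l)]
  have h1 : Tendsto (fun l => (p l).snd - W) (𝓝[>] 0) (𝓝 0) := by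
    simpa using hpW.sub_const W
  simpa using (h1.inner (𝕜 := ℝ) (((matOp hK.coefOp).continuous.tendsto 0).comp h1)).const_mul
    (1 / meanArea P)

/-- The effective diffusion tensor is the homogenized coefficient divided by the mean area. -/
lemma effective_of_limit {V : SurfaceSpace 2 → Matrix (Fin 2) (Fin 2) ℝ}
    (hV : ∀ i j, MemLp (fun h => V h i j) 2 P) (i j : Fin 2) :
    1 / meanArea P * ∫ h, ((1 + V h) * (metric 0 h)⁻¹ * (1 + V h).transpose) i j * area 0 h ∂P =
      1 / meanArea P *
        (hK.dualSystem hA hB).effective (fun i => toField (fun h => V h i) (hV i)) i j := by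
  have hrep : ∀ i k, (const (oneL2 P) (Pi.single i 1) + toField (fun h => V h i) (hV i)) k
      =ᵐ[P] fun h => (1 + V h) i k := fun i k => by
    rw [PiLp.add_apply, const_apply]
    filter_upwards [Lp.coeFn_add ((Pi.single i 1 : Fin 2 → ℝ) k • oneL2 P)
      (toField (fun h => V h i) (hV i) k), Lp.coeFn_smul ((Pi.single i 1 : Fin 2 → ℝ) k) (oneL2 P),
      coeFn_oneL2 (P := P), coeFn_toField (hV i) k] with h h1 h2 h3 h4
    rw [h1, Pi.add_apply, h2, Pi.smul_apply, h3, h4, Matrix.add_apply, Matrix.one_apply,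
      Pi.single_apply]
    simp [eq_comm]
  have h1 := hK.energy_eq (hrep i) (hrep j)
  rw [energy] at h1
  refine Eq.trans ?_ h1
  congr 2
  funext h
  congr 1
  rw [Matrix.mul_assoc]
  simp only [Matrix.mul_apply, dotProduct, Matrix.mulVec, Matrix.transpose_apply]

lemma exists_effective {D : Matrix (Fin 2) (Fin 2) ℝ} (hD : IsEffectiveDiffusion P D) :
    ∃ V : Fin 2 → VecField (Lp ℝ 2 P),
      (∀ i, (hK.dualSystem hA hB).IsCorrector (Pi.single i 1) (V i)) ∧
      ∀ i j, D i j = 1 / meanArea P * (hK.dualSystem hA hB).effective V i j := by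
  obtain ⟨V, hV, hDV⟩ := hD
  refine ⟨fun i => toField (fun h => V h i) (hV i).1,
    fun i => hK.isCorrector_of_isLimitCorrectorGradient hA hB (hV i), fun i j => ?_⟩
  rw [hDV, hK.effective_of_limit hA hB fun i => (hV i).1]

lemma existsUnique_isEffectiveDiffusion (hK : BoundedBy P K) (hA : IsStationary P) (hB : IsErgodicField P) :
    ∃! D : Matrix (Fin 2) (Fin 2) ℝ, IsEffectiveDiffusion P D := by
  choose V hV using fun i : Fin 2 => hK.exists_isLimitCorrectorGradient hA hB (Pi.single i 1)
  refine ⟨Matrix.of fun i j => 1 / meanArea P * ∫ h, ((1 + Matrix.of fun i => V i h) *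
    (metric 0 h)⁻¹ * (1 + Matrix.of fun i => V i h).transpose) i j * area 0 h ∂P,
    ⟨fun h => Matrix.of fun i => V i h, hV, fun i j => rfl⟩, fun D' hD' => ?_⟩
  obtain ⟨W, hW, hDW⟩ := hK.exists_effective hA hB hD'
  ext i j
  rw [hDW, Matrix.of_apply, hK.effective_of_limit hA hB (V := fun h => Matrix.of fun i => V i h)
    fun i => (hV i).1]
  congr 2
  funext k
  exact (hW k).unique (hK.isCorrector_of_isLimitCorrectorGradient hA hB (hV k))

/-- Averages the pointwise bound `√|g| g⁻¹ ≤ √|g| I`; this is the source of `D ≤ I`. -/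
lemma inner_const_le (x : Fin 2 → ℝ) :
    inner ℝ (const (oneL2 P) x) (matOp hK.coefOp (const (oneL2 P) x)) ≤
      meanArea P * (x 0 ^ 2 + x 1 ^ 2) := by
  have hc : ∀ i, (const (oneL2 P) x : VecField (Lp ℝ 2 P)) i =ᵐ[P] fun _ => x i := fun i => by
    rw [const_apply]
    filter_upwards [Lp.coeFn_smul (x i) (oneL2 P), coeFn_oneL2 (P := P)] with h h1 h2
    rw [h1, Pi.smul_apply, h2, smul_eq_mul, mul_one]
  obtain ⟨h1, h2⟩ := hK.integrable_and_inner_eq hc hc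
  rw [h2, meanArea, ← integral_mul_const]
  refine integral_mono h1 (hK.integrable_area.mul_const _) fun h => ?_
  rw [area_eq]
  exact slopeCoef_quadratic_le _ _ _

end BoundedBy

end SurfaceSpace

/-! ### Eigenvalues of the effective tensor. -/

/-- The eigenvalues of a nonnegative symmetric `2 × 2` matrix with determinant `m²` that is at
most the identity. -/
lemma exists_eigenvalues_of_det_eq_sq {D : Matrix (Fin 2) (Fin 2) ℝ} {m : ℝ} (hm : 0 < m)
    (hsymm : D 1 0 = D 0 1) (hdet : D.det = m ^ 2) (h0 : 0 ≤ D 0 0) (h1 : 0 ≤ D 1 1)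
    (hle : ∀ x y : ℝ, x ^ 2 * D 0 0 + 2 * (x * y) * D 0 1 + y ^ 2 * D 1 1 ≤ x ^ 2 + y ^ 2) :
    ∃ lam₁ lam₂ : ℝ, D.charpoly.roots = {lam₁, lam₂} ∧
      m ^ 2 ≤ lam₁ ∧ lam₁ ≤ m ∧ m ≤ lam₂ ∧ lam₂ ≤ 1 := by
  have hdet' : D 0 0 * D 1 1 - D 0 1 * D 0 1 = m ^ 2 := by
    rw [← hdet, Matrix.det_fin_two, hsymm]
  have h0le : D 0 0 ≤ 1 := by simpa using hle 1 0
  have h1le : D 1 1 ≤ 1 := by simpa using hle 0 1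
  -- `I - D` is nonnegative, so its determinant is, as seen from the discriminant of its quadratic
  -- form at `(x, 1)`.
  have hgap : 0 ≤ (1 - D 0 0) * (1 - D 1 1) - D 0 1 ^ 2 := by
    have := discrim_le_zero (a := 1 - D 0 0) (b := -2 * D 0 1) (c := 1 - D 1 1) fun x => by
      nlinarith [hle x 1]
    rw [discrim] at this
    nlinarith
  set t := D 0 0 + D 1 1 with ht
  set r := √((D 0 0 - D 1 1) ^ 2 + 4 * D 0 1 ^ 2) with hr
  have hr0 : 0 ≤ r := Real.sqrt_nonneg _
  have hrsq : r ^ 2 = t ^ 2 - 4 * m ^ 2 := by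
    rw [hr, Real.sq_sqrt (by positivity), ht]
    linear_combination -4 * hdet'
  have hprod : (t - r) / 2 * ((t + r) / 2) = m ^ 2 := by linear_combination -hrsq / 4
  have hm2 : 0 < m ^ 2 := by positivity
  have hpos : 0 < (t + r) / 2 := by
    have : 0 ≤ (t + r) / 2 := by positivity
    refine this.lt_of_ne fun h => ?_
    rw [← h, mul_zero] at hprod
    exact hm2.ne hprod
  have hle1 : (t + r) / 2 ≤ 1 := by
    -- `(2 - t)² - r²` is four times the determinant of `I - D`.
    have : r ≤ 2 - t := by
      refine abs_le_of_sq_le_sq' ?_ (by linarith) |>.2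
      rw [hrsq]
      nlinarith
    linarith
  have hmle : m ≤ (t + r) / 2 := by
    refine abs_le_of_sq_le_sq' ?_ hpos.le |>.2
    nlinarith
  refine ⟨(t - r) / 2, (t + r) / 2, ?_, ?_, ?_, hmle, hle1⟩
  · have hchar : D.charpoly = (Polynomial.X - Polynomial.C ((t - r) / 2)) *
        (Polynomial.X - Polynomial.C ((t + r) / 2)) := by
      rw [Matrix.charpoly_fin_two, hdet, ← hprod, Matrix.trace_fin_two, ← ht,
        show t = (t - r) / 2 + (t + r) / 2 by ring]
      simp only [Polynomial.C_add, Polynomial.C_mul]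
      ring_nf
    rw [hchar, Polynomial.roots_mul (mul_ne_zero (Polynomial.X_sub_C_ne_zero _)
      (Polynomial.X_sub_C_ne_zero _)), Polynomial.roots_X_sub_C, Polynomial.roots_X_sub_C]
    rfl
  -- The product is `m ^ 2` and the larger eigenvalue is at most `1`, so the smaller one is at least
  -- `m ^ 2`.
  · have : 0 ≤ (t - r) / 2 := nonneg_of_mul_nonneg_left (hprod ▸ hm2.le) hpos
    nlinarith
  · by_contra hlt
    push Not at hlt
    nlinarith

end

/-! ### The theorem. -/

theorem theorem6p1 (P : Measure (SurfaceSpace 2)) [IsProbabilityMeasure P]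
    (hA : SurfaceSpace.IsStationary P)
    (hB : SurfaceSpace.IsErgodicField P)
    (hC : SurfaceSpace.IsStochContinuous P)
    (hD : SurfaceSpace.HasBoundedDerivs P) :
    (∃! D : Matrix (Fin 2) (Fin 2) ℝ, SurfaceSpace.IsEffectiveDiffusion P D) ∧
    ∀ D : Matrix (Fin 2) (Fin 2) ℝ, SurfaceSpace.IsEffectiveDiffusion P D →
      D.det = 1 / SurfaceSpace.meanArea P ^ 2 ∧
      (∃ lam₁ lam₂ : ℝ, D.charpoly.roots = {lam₁, lam₂} ∧
        1 / SurfaceSpace.meanArea P ^ 2 ≤ lam₁ ∧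
        lam₁ ≤ 1 / SurfaceSpace.meanArea P ∧
        1 / SurfaceSpace.meanArea P ≤ lam₂ ∧
        lam₂ ≤ 1) ∧
      ((∃ c : ℝ, D = c • (1 : Matrix (Fin 2) (Fin 2) ℝ)) →
        D = (1 / SurfaceSpace.meanArea P) • (1 : Matrix (Fin 2) (Fin 2) ℝ)) := by
  obtain ⟨K, hK⟩ := hD.exists_boundedBy
  refine ⟨hK.existsUnique_isEffectiveDiffusion hA hB, fun D hDeff => ?_⟩
  obtain ⟨V, hV, hDV⟩ := hK.exists_effective hA hB hDeff
  set m := 1 / SurfaceSpace.meanArea P with hm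
  have hZ : 0 < SurfaceSpace.meanArea P := zero_lt_one.trans_le hK.one_le_meanArea
  have hmpos : 0 < m := by positivity
  have hmZ : m * SurfaceSpace.meanArea P = 1 := one_div_mul_cancel hZ.ne'
  have hdet : D.det = m ^ 2 := by
    rw [Matrix.det_fin_two, hDV, hDV, hDV, hDV]
    linear_combination m ^ 2 * DualSystem.effective_det hV
  have hsymm : D 1 0 = D 0 1 := by rw [hDV, hDV, DualSystem.effective_comm]
  have hnonneg : ∀ i, 0 ≤ D i i := fun i => by
    rw [hDV, DualSystem.effective, real_inner_comm]
    exact mul_nonneg hmpos.le ((mul_nonneg (hK.dualSystem hA hB).coer_pos.le (sq_nonneg _)).trans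
      ((hK.dualSystem hA hB).coercive _))
  have hle : ∀ x y : ℝ,
      x ^ 2 * D 0 0 + 2 * (x * y) * D 0 1 + y ^ 2 * D 1 1 ≤ x ^ 2 + y ^ 2 := fun x y => by
    have h1 := (DualSystem.effective_le hV ![x, y]).trans (hK.inner_const_le ![x, y])
    simp only [Fin.sum_univ_two, Matrix.cons_val_zero, Matrix.cons_val_one,
      DualSystem.effective_comm V 1 0] at h1
    have h2 := mul_le_mul_of_nonneg_left h1 hmpos.le
    rw [← mul_assoc, hmZ, one_mul] at h2
    rw [hDV, hDV, hDV]
    linarith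
  rw [← one_div_pow, ← hm]
  refine ⟨hdet, exists_eigenvalues_of_det_eq_sq hmpos hsymm hdet (hnonneg 0) (hnonneg 1) hle, ?_⟩
  rintro ⟨c, rfl⟩
  -- The determinant fixes only `c ^ 2`; nonnegativity of the diagonal selects the root.
  have hc : 0 ≤ c := by simpa using hnonneg 0
  have hcm : c ^ 2 = m ^ 2 := by rw [← hdet]; simp
  rw [(sq_eq_sq₀ hc hmpos.le).1 hcm]
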